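/- **Theorem 5.1 (Keller–Osserman theorem for $\Pi_k$-Hessian type equations).** Let $1\le k\le n$ be integers, put $C_n^k=\binom nk$, and for $\lambda\in\mathbb R^n$ let $$\Pi_k(\lambda)=\prod_{i_1<\dots<i_k}\ \sum_{s=1}^k\lambda_{i_s},\qquad \mathcal P_k=\Big\{\lambda\in\mathbb R^n:\ \sum_{s=1}^k\lambda_{i_s}>0\ \text{ for all } i_1<\dots<i_k\Big\}.$$ Let $f:\mathbb R\to(0,+\infty)$ be continuous and non-decreasing, $p>1$, $\alpha\ge\frac kn-1$ and $\beta<p-1$. Consider $$\Pi_k^{1/C_n^k}\big[D(|Du|^{p-2}Du)\big]=|x|^\alpha|Du|^\beta f(u)\quad\text{in }\mathbb R^n,\tag{1}$$ where $\Pi_k[A]=\Pi_k(\lambda(A))$, $\lambda(A)$ being the eigenvalues of the matrix $A$, and $|Du|^{p-2}Du$ is read as $0$ where $Du=0$. An *entire nontrivial admissible subsolution* of (1) is a non-constant function $u$ on $\mathbb R^n$ such that at every $x\ne0$ the matrix $D(|Du|^{p-2}Du)$ exists, has its eigenvalues (real, counted with multiplicity) in $\mathcal P_k$, and satisfies (1)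 with $\ge$ in place of $=$ (if $\beta<0$, the right-hand side is $+\infty$ at points $x\neq 0$ with $Du(x)=0$, so there are no such points). Consider also the condition $$\int^{+\infty}\Big(\int_0^t f^{\frac nk}(s)\,ds\Big)^{-\frac1{\frac{n(p-\beta-1)}k+1}}dt=+\infty,\tag{2}$$ with any positive number as the lower limit of the outer integral. (i) If $p\le\alpha+\beta+2$, then there exists an entire nontrivial admissible subsolution $u\in C^2(\mathbb R^n)$ of (1) if and only if (2) holds. (ii) If $p>\alpha+\beta+2$ and $(p-1)\alpha+\beta\ge0$, then for every $\delta\in\big(1,\frac{p-\beta-1}{p-\alpha-\beta-2}\big)$ there exists an entire nontrivial admissible subsolution $u\in C^1(\mathbb R^n)\cap C^2(\mathbb R^n\setminus\{0\})\cap W^{2,\delta}_{loc}(\mathbb R^n)$ of (1) if and only if (2) holds; and if (2) holds, then such a $u$ can be chosen with $|Du|^{p-2}Du\in C^1(\mathbb R^n)$. -/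

import Mathlib

open MeasureTheory

noncomputable section

namespace PiHessian

/-- Euclidean space `ℝⁿ`. -/
abbrev Eucl (n : ℕ) : Type := EuclideanSpace ℝ (Fin n)

/-- The product of all `k`-sums of `lam`: `Π_k(λ) = ∏_{i₁ < ⋯ < i_k} (λ_{i₁} + ⋯ + λ_{i_k})`. -/
def PiK {n : ℕ} (k : ℕ) (lam : Fin n → ℝ) : ℝ :=
  ∏ s ∈ Finset.powersetCard k (Finset.univ : Finset (Fin n)), ∑ i ∈ s, lam i

/-- The cone `𝒫_k` of all `λ ∈ ℝⁿ` all of whose `k`-sums are positive. -/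
def coneP (n k : ℕ) : Set (Fin n → ℝ) :=
  {lam | ∀ s ∈ Finset.powersetCard k (Finset.univ : Finset (Fin n)), 0 < ∑ i ∈ s, lam i}

/-- `lam` lists the eigenvalues of the linear map `A`, with algebraic multiplicity. It is
determined by `A` up to its order, on which neither `PiK` nor `coneP` depends. -/
def IsEigenvalueTuple {n : ℕ} (A : Eucl n →L[ℝ] Eucl n) (lam : Fin n → ℝ) : Prop :=
  (A : Eucl n →ₗ[ℝ] Eucl n).charpoly = ∏ i, (Polynomial.X - Polynomial.C (lam i))

/-- The vector field `|Du|^{p-2} Du`; its value is `0` where `Du = 0`. -/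
def pField {n : ℕ} (p : ℝ) (u : Eucl n → ℝ) (x : Eucl n) : Eucl n :=
  ‖gradient u x‖ ^ (p - 2) • gradient u x

/-- At the point `x` the matrix `D(|Du|^{p-2}Du)` exists, its eigenvalues `λ` lie in `𝒫_k`, and
`Π_k(λ)^{1/C(n,k)} ≥ |x|^α |Du(x)|^β f(u(x))`. For `β < 0` the right-hand side is `+∞` where
`Du = 0`, so that the inequality fails there; this is the last clause. Meant for `x ≠ 0`. -/
def IsAdmissibleSubsolutionAt {n : ℕ} (k : ℕ) (p α β : ℝ) (f : ℝ → ℝ) (u : Eucl n → ℝ)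
    (x : Eucl n) : Prop :=
  DifferentiableAt ℝ (pField p u) x ∧
  (∃ lam : Fin n → ℝ, IsEigenvalueTuple (fderiv ℝ (pField p u) x) lam ∧ lam ∈ coneP n k ∧
    ‖x‖ ^ α * ‖gradient u x‖ ^ β * f (u x) ≤ (PiK k lam) ^ (1 / (n.choose k : ℝ))) ∧
  (β < 0 → gradient u x ≠ 0)

/-- Entire nontrivial (i.e. nonconstant) admissible subsolutions of
`Π_k^{1/C(n,k)}[D(|Du|^{p-2}Du)] = |x|^α |Du|^β f(u)`. The equation is degenerate or singular
at the origin, where nothing is asked for; regularity is stated separately. -/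
def IsEntireSubsolution {n : ℕ} (k : ℕ) (p α β : ℝ) (f : ℝ → ℝ) (u : Eucl n → ℝ) : Prop :=
  (∃ x y, u x ≠ u y) ∧ ∀ x, x ≠ 0 → IsAdmissibleSubsolutionAt k p α β f u x

/-- `g` is the weak partial derivative `∂_i u` on `ℝⁿ`. -/
def IsWeakPartial {n : ℕ} (i : Fin n) (u g : Eucl n → ℝ) : Prop :=
  LocallyIntegrable u volume ∧ LocallyIntegrable g volume ∧
  ∀ φ : Eucl n → ℝ, ContDiff ℝ ((⊤ : ℕ∞) : WithTop ℕ∞) φ → HasCompactSupport φ →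
    ∫ x, u x * fderiv ℝ φ x (EuclideanSpace.single i (1 : ℝ)) = - ∫ x, g x * φ x

/-- `L^δ_loc(ℝⁿ)`. -/
def MemLpLoc {n : ℕ} (δ : ℝ) (g : Eucl n → ℝ) : Prop :=
  ∀ K : Set (Eucl n), IsCompact K → MemLp g (ENNReal.ofReal δ) (volume.restrict K)

/-- `W^{2,δ}_loc(ℝⁿ)`, for `δ ≥ 1`. -/
def MemW2Loc {n : ℕ} (δ : ℝ) (u : Eucl n → ℝ) : Prop :=
  MemLpLoc δ u ∧
  ∃ (g : Fin n → Eucl n → ℝ) (G : Fin n → Fin n → Eucl n → ℝ),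
    (∀ i, MemLpLoc δ (g i) ∧ IsWeakPartial i u (g i)) ∧
    ∀ i j, MemLpLoc δ (G i j) ∧ IsWeakPartial j (g i) (G i j)

/-- The Keller–Osserman condition
`∫^∞ (∫_0^t f(s)^{n/k} ds)^{-1/(n(p-β-1)/k+1)} dt = ∞`, for every positive lower limit. -/
def KellerOsserman (n k : ℕ) (p β : ℝ) (f : ℝ → ℝ) : Prop :=
  ∀ c : ℝ, 0 < c →
    ∫⁻ t in Set.Ioi c, ENNReal.ofReal
      ((∫ s in (0 : ℝ)..t, f s ^ ((n : ℝ) / k)) ^ (-(1 / ((n : ℝ) * (p - β - 1) / k + 1)))) = ⊤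

end PiHessian

end

namespace PiHessian

/-! Put `ν = n/k`, `q = n(p-β-1)/k`, `g = f^ν`. For a radial function with slope `d > 0` and second
derivative `b`, the matrix has the eigenvalue `(p-1) d^(p-2) b` once and `d^(p-1)/r` otherwise. A
fraction `k/n` of the `k`-subsets contains the radial index, so the `ν`-th power of the inequality
is linear in `b` (`le_PiK_update_iff`): `r^(αν+ν-1) g(u) ≤ k^(ν-1) d^(q-1) ((p-1) b + (k-1) d/r)`.
Up to weights this is `u'^(q-1) u'' ≈ g(u)`, which integrates to `u' ≈ w(u)` with `w = F^(1/(q+1))`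
and `F` a primitive of `g`. The Keller–Osserman integral is the "time" `∫ dt/w(t)` that this flow
needs to reach infinity.

Sufficiency (`exists_radial_subsolution`): if that time is infinite, `ψ' = w(ψ)` has a global
solution, and `u(x) = ψ(K|x|^m)` is a subsolution for large `K`, where `(m-1)q = αν+ν` balances the
powers of `r`. The same `u` serves both parts. Its gradient is a `C¹` function times `|x|^(m-2) x`,
so its regularity at the origin depends only on `m`.

Necessity (`kellerOsserman_of_subsolution`): a subsolution need not be radial and is compared
directly with a radial function. If the time is finite, then `S = ∫ dt/w` is bounded by some `L`.
Let `ζ` vanish on the unit ball and rise slowly to `L` at radius `1 + R`. The maximum of `S(u) - ζ`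
cannot lie on the outer sphere. A maximum in the unit ball can be moved to the unit sphere by the
weak maximum principle (`exists_sphere_forall_le`), and there `ζ` is too flat for a matrix with a
positive eigenvalue (`not_flat_of_pos_eigenvalue`). Farther out, the eigenvalues at the touching
point are dominated by those of the radial function `S⁻¹(ζ)` (`eigenvalue_le_of_isLocalMax`), and
`Π_k` is monotone on the cone; for large `R` the inequality becomes `g(u) < g(u)`. -/

/-! ### The operator on tuples (a, b, …, b), and the cone -/

open Finset in
lemma PiK_update {n k : ℕ} (hk : 1 ≤ k) (a b : ℝ) (i₀ : Fin n) :
    PiK k (Function.update (fun _ => b) i₀ a) =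
      (a + (k - 1) * b) ^ (n - 1).choose (k - 1) * (k * b) ^ (n - 1).choose k := by
  obtain ⟨j, rfl⟩ : ∃ j, k = j + 1 := ⟨k - 1, by omega⟩
  have hcard : (univ.erase i₀ : Finset (Fin n)).card = n - 1 := by simp
  have hnot : i₀ ∉ (univ.erase i₀ : Finset (Fin n)) := by simp
  have hsum : ∀ s ⊆ (univ.erase i₀ : Finset (Fin n)),
      ∑ i ∈ s, Function.update (fun _ => b) i₀ a i = s.card * b := by
    intro s hs
    rw [sum_congr rfl (g := fun _ => b)]
    · simp
    · intro i hi
      exact Function.update_of_ne (ne_of_mem_erase (hs hi)) _ _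
  have hins : (univ : Finset (Fin n)) = insert i₀ (univ.erase i₀) :=
    (insert_erase (mem_univ _)).symm
  unfold PiK
  -- Each `k`-subset avoiding `i₀` contributes `k b`; each one containing it contributes `a + (k -
  -- 1) b`.
  rw [hins, powersetCard_succ_insert hnot, prod_union, prod_image]
  · rw [mul_comm]
    congr 1
    · rw [prod_congr rfl (g := fun _ => a + ((j + 1 : ℕ) - 1) * b), prod_const, card_powersetCard,
        hcard]
      · simp
      · intro s hs
        rw [mem_powersetCard] at hs
        rw [sum_insert (fun h => hnot (hs.1 h)), hsum s hs.1, hs.2]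
        simp
    · rw [prod_congr rfl (g := fun _ => ((j + 1 : ℕ) : ℝ) * b), prod_const, card_powersetCard,
        hcard]
      intro s hs
      rw [mem_powersetCard] at hs
      rw [hsum s hs.1, hs.2]
  · intro s hs t ht hst
    rw [mem_coe] at hs ht
    have h1 : i₀ ∉ s := fun h => hnot ((mem_powersetCard.1 hs).1 h)
    have h2 : i₀ ∉ t := fun h => hnot ((mem_powersetCard.1 ht).1 h)
    rw [← erase_insert h1, ← erase_insert h2, hst]
  · rw [disjoint_left]
    intro s hs hs'
    obtain ⟨t, -, rfl⟩ := mem_image.1 hs'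
    exact hnot ((mem_powersetCard.1 hs).1 (mem_insert_self _ _))

/-- These are the proportions of `k`-subsets that contain, respectively avoid, a fixed index; they
become the exponents of the two factors of the normalized operator. -/
lemma choose_pred_ratio {n k : ℕ} (hk : 1 ≤ k) (hkn : k ≤ n) :
    ((n - 1).choose (k - 1) : ℝ) * (1 / (n.choose k : ℝ)) = k / n ∧
      ((n - 1).choose k : ℝ) * (1 / (n.choose k : ℝ)) = 1 - k / n := by
  obtain ⟨j, rfl⟩ : ∃ j, k = j + 1 := ⟨k - 1, by omega⟩
  obtain ⟨m, rfl⟩ : ∃ m, n = m + 1 := ⟨n - 1, by omega⟩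
  have h1 : ((m + 1).choose (j + 1) : ℝ) ≠ 0 := by
    exact_mod_cast (Nat.choose_pos hkn).ne'
  have h2 : ((m + 1 : ℕ) : ℝ) ≠ 0 := by positivity
  have h3 : ((m + 1 : ℕ) : ℝ) * (m.choose j : ℝ) = (m + 1).choose (j + 1) * ((j + 1 : ℕ) : ℝ) := by
    exact_mod_cast Nat.add_one_mul_choose_eq m j
  have h4 : ((m + 1).choose (j + 1) : ℝ) = m.choose j + m.choose (j + 1) := by
    exact_mod_cast Nat.choose_succ_succ m j
  simp only [Nat.add_sub_cancel]
  have h5 : (m.choose j : ℝ) * (1 / ((m + 1).choose (j + 1) : ℝ)) = ((j + 1 : ℕ) : ℝ) / ((m + 1 : ℕ) : ℝ) := by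
    field_simp
    linarith
  refine ⟨h5, ?_⟩
  rw [← h5, eq_sub_iff_add_eq, ← add_mul, add_comm (m.choose (j + 1) : ℝ), ← h4]
  field_simp

lemma PiK_update_rpow {n k : ℕ} (hk : 1 ≤ k) (hkn : k ≤ n) {a b : ℝ} (i₀ : Fin n)
    (hb : 0 ≤ b) (hab : 0 ≤ a + (k - 1) * b) :
    (PiK k (Function.update (fun _ => b) i₀ a)) ^ (1 / (n.choose k : ℝ)) =
      (a + (k - 1) * b) ^ ((k : ℝ) / n) * (k * b) ^ (1 - (k : ℝ) / n) := by
  have hkb : 0 ≤ k * b := by positivity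
  obtain ⟨h1, h2⟩ := choose_pred_ratio hk hkn
  rw [PiK_update hk, Real.mul_rpow (pow_nonneg hab _) (pow_nonneg hkb _),
    ← Real.rpow_natCast, ← Real.rpow_natCast, ← Real.rpow_mul hab, ← Real.rpow_mul hkb, h1, h2]

/-- The `n/k`-th power of the operator on the tuple `(a, b, …, b)`. -/
lemma PiK_update_rpow_rpow {n k : ℕ} (hk : 1 ≤ k) (hkn : k ≤ n) {a b : ℝ} (i₀ : Fin n)
    (hb : 0 ≤ b) (hab : 0 ≤ a + (k - 1) * b) :
    ((PiK k (Function.update (fun _ => b) i₀ a)) ^ (1 / (n.choose k : ℝ))) ^ ((n : ℝ) / k) =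
      (a + (k - 1) * b) * (k * b) ^ ((n : ℝ) / k - 1) := by
  have hk0 : (k : ℝ) ≠ 0 := by positivity
  have hn0 : (n : ℝ) ≠ 0 := by
    have : 0 < n := by omega
    positivity
  have hkb : 0 ≤ k * b := by positivity
  rw [PiK_update_rpow hk hkn i₀ hb hab, Real.mul_rpow (by positivity) (by positivity),
    ← Real.rpow_mul hab, ← Real.rpow_mul hkb]
  congr 1
  · rw [div_mul_div_cancel₀ hn0, div_self hk0, Real.rpow_one]
  · congr 1
    field_simp

/-- Only the smaller tuple has to be in the cone: its factors are positive and each of them grows.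
-/
lemma PiK_le_of_coneP {n k : ℕ} {lam mu : Fin n → ℝ} (hlam : lam ∈ coneP n k)
    (h : ∀ i, lam i ≤ mu i) : PiK k lam ≤ PiK k mu :=
  Finset.prod_le_prod (fun s hs => (hlam s hs).le) (fun _ _ => Finset.sum_le_sum fun i _ => h i)

lemma PiK_pos {n k : ℕ} {lam : Fin n → ℝ} (hlam : lam ∈ coneP n k) : 0 < PiK k lam :=
  Finset.prod_pos hlam

lemma exists_mem_powersetCard {n k : ℕ} (hk : 1 ≤ k) (hkn : k ≤ n) (i₀ : Fin n) :
    ∃ s ∈ Finset.powersetCard k (Finset.univ : Finset (Fin n)), i₀ ∈ s := by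
  obtain ⟨s, h1, -, h2⟩ := Finset.exists_subsuperset_card_eq (Finset.subset_univ {i₀})
    (n := k) (by simpa using hk) (by simpa using hkn)
  exact ⟨s, by simp [Finset.mem_powersetCard, h2], h1 (by simp)⟩

/-- This weak form of admissibility is all that the maximum principle and the flatness argument use.
-/
lemma exists_pos_of_coneP {n k : ℕ} (hk : 1 ≤ k) (hkn : k ≤ n) {lam : Fin n → ℝ}
    (hlam : lam ∈ coneP n k) : ∃ i, 0 < lam i := by
  obtain ⟨s, hs, -⟩ := exists_mem_powersetCard hk hkn ⟨0, by omega⟩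
  by_contra! h
  exact absurd (hlam s hs) (not_lt.2 (Finset.sum_nonpos fun i _ => h i))

/-- In the cone, a tuple dominated by `(a, b, …, b)` has `0 < a + (k - 1) b`. -/
lemma pos_of_coneP_of_le_update {n k : ℕ} (hk : 1 ≤ k) (hkn : k ≤ n) {lam : Fin n → ℝ}
    (hlam : lam ∈ coneP n k) {a b : ℝ} {i₀ : Fin n}
    (h : ∀ i, lam i ≤ Function.update (fun _ => b) i₀ a i) : 0 < a + (k - 1) * b := by
  obtain ⟨s, hs, hi⟩ := exists_mem_powersetCard hk hkn i₀
  have h1 := (hlam s hs).trans_le (Finset.sum_le_sum fun i _ => h i)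
  rw [← Finset.insert_erase hi, Finset.sum_insert (by simp), Function.update_self,
    Finset.sum_congr rfl (g := fun _ => b)] at h1
  · have hc : ((s.erase i₀).card : ℝ) = k - 1 := by
      rw [Finset.card_erase_of_mem hi, (Finset.mem_powersetCard.1 hs).2, Nat.cast_sub hk]
      simp
    simpa [hc] using h1
  · intro i hi
    exact Function.update_of_ne (Finset.ne_of_mem_erase hi) _ _

lemma update_mem_coneP {n k : ℕ} (hk : 1 ≤ k) {a b : ℝ} (ha : 0 < a) (hb : 0 < b) (i₀ : Fin n) :
    Function.update (fun _ => b) i₀ a ∈ coneP n k := by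
  intro s hs
  refine Finset.sum_pos (fun i _ => ?_) ?_
  · rcases eq_or_ne i i₀ with rfl | h
    · simpa using ha
    · simpa [h] using hb
  · rw [← Finset.card_pos, (Finset.mem_powersetCard.1 hs).2]
    omega

/-! ### Eigenvalues of rank-one perturbations and of products with a Hessian -/

open Polynomial in
/-- Two listings of the roots of the same polynomial differ by a permutation. -/
lemma exists_equiv_of_prod_X_sub_C_eq {n : ℕ} {lam mu : Fin n → ℝ}
    (h : ∏ i, (X - C (lam i)) = ∏ i, (X - C (mu i))) :
    ∃ σ : Fin n ≃ Fin n, ∀ i, mu (σ i) = lam i := by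
  have hroots : Multiset.map lam Finset.univ.val = Multiset.map mu Finset.univ.val := by
    have := congrArg Polynomial.roots h
    rwa [Finset.prod, Finset.prod, ← Function.comp_def (fun a => X - C a) lam,
      ← Function.comp_def (fun a => X - C a) mu, ← Multiset.map_map, ← Multiset.map_map,
      roots_multiset_prod_X_sub_C, roots_multiset_prod_X_sub_C] at this
  -- The fibres over each value have the same size, its multiplicity as a root; bijections between
  -- fibres glue to a permutation.
  have hcard : ∀ c, Nonempty ({i // lam i = c} ≃ {i // mu i = c}) := by
    intro c
    have := congrArg (Multiset.count c) hroots
    rw [Multiset.count_map, Multiset.count_map] at this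
    refine Fintype.card_eq.1 ?_
    rw [Fintype.card_subtype, Fintype.card_subtype]
    simpa [Finset.card, eq_comm] using this
  have e := fun c => (hcard c).some
  exact ⟨Equiv.ofFiberEquiv e, fun i => Equiv.ofFiberEquiv_map e i⟩

open Polynomial in
/-- The eigenvalues of `b I + c x ⊗ x`. -/
lemma isEigenvalueTuple_smul_id_add_rankOne {n : ℕ} (b c : ℝ) {x : Eucl n} (hx : x ≠ 0)
    (i₀ : Fin n) :
    IsEigenvalueTuple (b • ContinuousLinearMap.id ℝ (Eucl n) + c • InnerProductSpace.rankOne ℝ x x)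
      (Function.update (fun _ => b) i₀ (b + c * ‖x‖ ^ 2)) := by
  have hx' : ‖x‖ ≠ 0 := norm_ne_zero_iff.2 hx
  -- In an orthonormal basis with `x / ‖x‖` at index `i₀` the map is diagonal.
  obtain ⟨e, he⟩ := Orthonormal.exists_orthonormalBasis_extension_of_card_eq
    (𝕜 := ℝ) (E := Eucl n) (ι := Fin n) (by simp) (v := fun _ => ‖x‖⁻¹ • x) (s := {i₀}) (by
      refine ⟨fun i => ?_, fun i j hij => ?_⟩
      · simp [norm_smul, hx']
      · exact absurd (Subsingleton.elim i j) hij)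
  have hxe : x = ‖x‖ • e i₀ := by
    rw [he i₀ rfl, smul_smul, mul_inv_cancel₀ hx', one_smul]
  set r := ‖x‖ with hr
  unfold IsEigenvalueTuple
  rw [← LinearMap.charpoly_toMatrix _ e.toBasis]
  have : LinearMap.toMatrix e.toBasis e.toBasis
      ((b • ContinuousLinearMap.id ℝ (Eucl n) + c • InnerProductSpace.rankOne ℝ x x :
        Eucl n →L[ℝ] Eucl n) : Eucl n →ₗ[ℝ] Eucl n) =
      Matrix.diagonal (Function.update (fun _ => b) i₀ (b + c * r ^ 2)) := by
    ext i j
    have hij : ∀ i j, inner ℝ (e i) (e j) = if i = j then (1 : ℝ) else 0 :=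
      orthonormal_iff_ite.1 e.orthonormal
    rw [LinearMap.toMatrix_apply, Matrix.diagonal_apply, hxe]
    simp only [OrthonormalBasis.coe_toBasis, OrthonormalBasis.coe_toBasis_repr_apply,
      OrthonormalBasis.repr_apply_apply, ContinuousLinearMap.coe_coe, add_apply,
      smul_apply, ContinuousLinearMap.id_apply,
      InnerProductSpace.rankOne_apply, inner_add_right, inner_smul_right, inner_smul_left, hij]
    by_cases h1 : i = j
    · subst h1
      by_cases h2 : i = i₀
      · subst h2; simp [pow_two]
      · simp [h2]
    · by_cases h2 : i = i₀
      · subst h2; simp [h1]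
      · simp [h1, h2]
  rw [this, Matrix.charpoly_diagonal]

/-- Let `H` be symmetric with `H ≤ a e ⊗ e + b (I - e ⊗ e)`, `|e| = 1`. Then among the eigenvalues
of `c (I + (p - 2) e ⊗ e) H` one is at most `c (p - 1) a` and the others are at most `c b`. -/
lemma exists_eigenvalue_le {n : ℕ} {p c a b : ℝ} (hp : 1 < p) (hc : 0 < c) {e : Eucl n}
    (he : ‖e‖ = 1) {H : Eucl n →L[ℝ] Eucl n} (hsymm : ∀ x y, inner ℝ (H x) y = inner ℝ x (H y))
    (hle : ∀ h, inner ℝ (H h) h ≤ a * inner ℝ e h ^ 2 + b * (‖h‖ ^ 2 - inner ℝ e h ^ 2))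
    {lam : Fin n → ℝ}
    (hlam : IsEigenvalueTuple ((c • (ContinuousLinearMap.id ℝ (Eucl n) +
      (p - 2) • InnerProductSpace.rankOne ℝ e e)).comp H) lam) :
    ∃ i₀, ∀ i, lam i ≤ Function.update (fun _ => c * b) i₀ (c * (p - 1) * a) i := by
  have hee : inner ℝ e e = (1 : ℝ) := by rw [real_inner_self_eq_norm_sq, he]; norm_num
  -- `I + (p - 2) e ⊗ e` is the square of the map that stretches the direction `e` by `κ = √(p -
  -- 1)`.
  obtain ⟨κ, hκ, hκp⟩ : ∃ κ : ℝ, 0 < κ ∧ κ ^ 2 = p - 1 :=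
    ⟨√(p - 1), Real.sqrt_pos.2 (by linarith), Real.sq_sqrt (by linarith)⟩
  have hκi : κ⁻¹ * κ = 1 := inv_mul_cancel₀ hκ.ne'
  -- the square root of the diffusion matrix
  let Q : ℝ → Eucl n →ₗ[ℝ] Eucl n := fun t =>
    LinearMap.id + (t - 1) • (InnerProductSpace.rankOne ℝ e e : Eucl n →ₗ[ℝ] Eucl n)
  have hQ : ∀ t x, Q t x = x + (t - 1) • (inner ℝ e x • e) := fun t x => by simp [Q]
  have hQe : ∀ t x, inner ℝ e (Q t x) = t * inner ℝ e x := fun t x => by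
    rw [hQ, inner_add_right, inner_smul_right, inner_smul_right, hee]; ring
  have hQQ : ∀ s t x, Q s (Q t x) = Q (s * t) x := fun s t x => by
    rw [hQ s, hQe, hQ, hQ]; module
  have hQ1 : ∀ x, Q 1 x = x := fun x => by rw [hQ]; simp
  have hQsymm : ∀ t x y, inner ℝ (Q t x) y = inner ℝ x (Q t y) := fun t x y => by
    rw [hQ, hQ, inner_add_left, inner_add_right, inner_smul_left, inner_smul_right,
      inner_smul_left, inner_smul_right, real_inner_comm e x, RCLike.conj_to_real,
      RCLike.conj_to_real]
    ring
  have hQnorm : ∀ t x, ‖Q t x‖ ^ 2 = ‖x‖ ^ 2 + (t ^ 2 - 1) * inner ℝ e x ^ 2 := fun t x => by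
    rw [← real_inner_self_eq_norm_sq, hQsymm, hQQ, hQ, inner_add_right, inner_smul_right,
      inner_smul_right, real_inner_self_eq_norm_sq, real_inner_comm e x]
    ring
  -- The product with `H` need not be symmetric, but conjugation by this root turns it into the
  -- symmetric `S`, to which Rayleigh quotients apply.
  let E : Eucl n ≃ₗ[ℝ] Eucl n := LinearEquiv.ofLinearMap (Q κ⁻¹) (Q κ)
    (LinearMap.ext fun x => by simp [hQQ, hκi, hQ1])
    (LinearMap.ext fun x => by simp [hQQ, mul_comm κ, hκi, hQ1])
  let S : Eucl n →ₗ[ℝ] Eucl n := c • (Q κ ∘ₗ (H : Eucl n →ₗ[ℝ] Eucl n) ∘ₗ Q κ)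
  have hS : ∀ x, S x = c • Q κ (H (Q κ x)) := fun x => rfl
  have hSsymm : S.IsSymmetric := fun x y => by
    rw [hS, hS, inner_smul_left, inner_smul_right, hQsymm, hsymm, hQsymm]; rfl
  have hSle : ∀ h, inner ℝ (S h) h ≤
      c * (p - 1) * a * inner ℝ e h ^ 2 + c * b * (‖h‖ ^ 2 - inner ℝ e h ^ 2) := fun h => by
    rw [hS, inner_smul_left, hQsymm]
    have := mul_le_mul_of_nonneg_left (hle (Q κ h)) hc.le
    rw [hQe, hQnorm] at this
    refine this.trans (le_of_eq ?_)
    rw [← hκp]; ring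
  have hconj : E.conj ((c • (ContinuousLinearMap.id ℝ (Eucl n) +
      (p - 2) • InnerProductSpace.rankOne ℝ e e)).comp H : Eucl n →L[ℝ] Eucl n) = S := by
    ext1 x
    have h1 : ∀ y, y + (p - 2) • (inner ℝ e y • e) = Q (κ * κ) y := fun y => by
      rw [hQ, ← pow_two, hκp]; congr 2; ring
    change Q κ⁻¹ (c • (H (Q κ x) + (p - 2) • (inner ℝ e (H (Q κ x)) • e))) = _
    rw [h1, map_smul, hQQ, ← mul_assoc, hκi, one_mul, hS]
  have hfr : Module.finrank ℝ (Eucl n) = n := by simp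
  unfold IsEigenvalueTuple at hlam
  rw [← LinearEquiv.charpoly_conj E, hconj, hSsymm.charpoly_eq hfr] at hlam
  obtain ⟨σ, hσ⟩ : ∃ σ : Fin n ≃ Fin n, ∀ i, hSsymm.eigenvalues hfr (σ i) = lam i :=
    exists_equiv_of_prod_X_sub_C_eq hlam.symm
  set v := hSsymm.eigenvectorBasis hfr with hv
  set mu := hSsymm.eigenvalues hfr with hmu
  have hvij : ∀ i j, inner ℝ (v i) (v j) = if i = j then (1 : ℝ) else 0 :=
    orthonormal_iff_ite.1 v.orthonormal
  have hSv : ∀ i, S (v i) = mu i • v i := fun i => by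
    exact hSsymm.apply_eigenvectorBasis hfr i
  have hmui : ∀ i, mu i ≤ c * (p - 1) * a * inner ℝ e (v i) ^ 2 +
      c * b * (1 - inner ℝ e (v i) ^ 2) := fun i => by
    have := hSle (v i)
    rw [hSv, inner_smul_left, hvij] at this
    simpa using this
  have hcoef : ∀ i, inner ℝ e (v i) ^ 2 ≤ (1 : ℝ) := fun i => by
    have := abs_real_inner_le_norm e (v i)
    rw [he, v.orthonormal.1 i, one_mul] at this
    exact (sq_le_one_iff_abs_le_one _).2 this
  suffices ∃ i₀, ∀ i, mu i ≤ Function.update (fun _ => c * b) i₀ (c * (p - 1) * a) i by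
    obtain ⟨i₀, h⟩ := this
    refine ⟨σ.symm i₀, fun i => ?_⟩
    have h1 := h (σ i)
    rw [hσ] at h1
    refine h1.trans (le_of_eq ?_)
    by_cases hi : σ i = i₀
    · have : i = σ.symm i₀ := by rw [← hi]; simp
      rw [hi, this]; simp
    · have : i ≠ σ.symm i₀ := fun h => hi (by rw [h]; simp)
      rw [Function.update_of_ne hi, Function.update_of_ne this]
  set A := c * (p - 1) * a
  set B := c * b
  -- If `A ≤ B`, every eigenvalue is at most `B`, and the Rayleigh quotient at `e` forces one to be
  -- at most `A`. If `B ≤ A`, every eigenvalue is at most `A`, and at most one exceeds `B`.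
  rcases le_total A B with hAB | hAB
  · obtain ⟨i₀, hi₀⟩ : ∃ i₀, mu i₀ ≤ A := by
      by_contra! hlt
      have h1 : inner ℝ (S e) e = ∑ i, mu i * inner ℝ e (v i) ^ 2 := by
        rw [← v.sum_inner_mul_inner]
        refine Finset.sum_congr rfl fun i _ => ?_
        rw [hSsymm, hSv, inner_smul_right, real_inner_comm e (v i)]
        ring
      have h2 : ∑ i, inner ℝ e (v i) ^ 2 = (1 : ℝ) := by
        rw [← hee, ← v.sum_inner_mul_inner]
        refine Finset.sum_congr rfl fun i _ => ?_
        rw [real_inner_comm e (v i)]; ring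
      have h3 := hSle e
      rw [h1, hee, he] at h3
      have h4 : A = ∑ i, A * inner ℝ e (v i) ^ 2 := by rw [← Finset.mul_sum, h2, mul_one]
      obtain ⟨j, hj⟩ : ∃ j, inner ℝ e (v j) ^ 2 ≠ (0 : ℝ) := by
        by_contra! h0
        simp [h0] at h2
      have h5 : ∑ i, A * inner ℝ e (v i) ^ 2 < ∑ i, mu i * inner ℝ e (v i) ^ 2 := by
        refine Finset.sum_lt_sum (fun i _ => mul_le_mul_of_nonneg_right (hlt i).le (sq_nonneg _))
          ⟨j, Finset.mem_univ _, mul_lt_mul_of_pos_right (hlt j) ?_⟩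
        exact lt_of_le_of_ne (sq_nonneg _) hj.symm
      linarith
    refine ⟨i₀, fun i => ?_⟩
    rcases eq_or_ne i i₀ with rfl | hi
    · simpa using hi₀
    · rw [Function.update_of_ne hi]
      nlinarith [hmui i, sq_nonneg (inner ℝ e (v i) : ℝ), hcoef i]
  · have hle' : ∀ i, mu i ≤ A := fun i => by
      nlinarith [hmui i, sq_nonneg (inner ℝ e (v i) : ℝ), hcoef i]
    have hne : ∀ i j, i ≠ j → B < mu i → B < mu j → False := by
      intro i j hij hi hj
      set s : ℝ := inner ℝ e (v i)
      set t : ℝ := inner ℝ e (v j)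
      have hst : s ^ 2 + t ^ 2 ≠ 0 := by
        intro h0
        have hs0 : s ^ 2 = 0 := by nlinarith [sq_nonneg s, sq_nonneg t]
        have := hmui i
        rw [hs0] at this
        linarith
      have hpos : 0 < s ^ 2 + t ^ 2 := lt_of_le_of_ne (by positivity) hst.symm
      -- This vector in the span of two eigenvectors is orthogonal to `e`, so its Rayleigh quotient
      -- is at most `B`.
      have h1 := hSle (t • v i - s • v j)
      have h2 : inner ℝ e (t • v i - s • v j) = 0 := by
        rw [inner_sub_right, inner_smul_right, inner_smul_right]; ring
      have h3 : ‖t • v i - s • v j‖ ^ 2 = s ^ 2 + t ^ 2 := by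
        rw [← real_inner_self_eq_norm_sq]
        simp [inner_sub_left, inner_sub_right, inner_smul_left, inner_smul_right, hvij, hij,
          hij.symm, -inner_self_eq_norm_sq_to_K]
        ring
      have h4 : inner ℝ (S (t • v i - s • v j)) (t • v i - s • v j) =
          mu i * t ^ 2 + mu j * s ^ 2 := by
        rw [map_sub, map_smul, map_smul, hSv, hSv]
        simp [inner_sub_left, inner_sub_right, inner_smul_left, inner_smul_right, hvij, hij,
          hij.symm, -inner_self_eq_norm_sq_to_K]
        ring
      rw [h2, h3, h4] at h1
      rcases eq_or_ne s 0 with hs | hs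
      · have ht : 0 < t ^ 2 := by rw [hs] at hpos; simpa using hpos
        rw [hs] at h1
        nlinarith
      · have : 0 < s ^ 2 := by positivity
        nlinarith [sq_nonneg t]
    by_cases hex : ∃ i, B < mu i
    · obtain ⟨i₀, hi₀⟩ := hex
      refine ⟨i₀, fun i => ?_⟩
      rcases eq_or_ne i i₀ with rfl | hi
      · simpa using hle' i
      · rw [Function.update_of_ne hi]
        by_contra! h
        exact hne i i₀ hi h hi₀
    · push Not at hex
      have hn : Nonempty (Fin n) := by
        by_contra h0
        rw [not_nonempty_iff] at h0
        have : e = 0 := Subsingleton.elim _ _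
        rw [this] at he
        simp at he
      obtain ⟨i₀⟩ := hn
      refine ⟨i₀, fun i => ?_⟩
      rcases eq_or_ne i i₀ with rfl | hi
      · simpa using hle' i
      · rw [Function.update_of_ne hi]
        exact hex i

/-! ### Radial derivatives and second order comparison at a touching point -/

open Filter Topology

lemma hasFDerivAt_norm_of_ne {E : Type*} [NormedAddCommGroup E] [InnerProductSpace ℝ E] {x : E}
    (hx : x ≠ 0) : HasFDerivAt (fun y : E => ‖y‖) (‖x‖⁻¹ • innerSL ℝ x) x := by
  have h1 : HasFDerivAt (fun y : E => √(‖y‖ ^ 2)) _ x :=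
    (hasStrictFDerivAt_norm_sq x).hasFDerivAt.sqrt (by positivity)
  simp only [Real.sqrt_sq (norm_nonneg _)] at h1
  convert! h1 using 1
  ext h
  have : ‖x‖ ≠ 0 := norm_ne_zero_iff.2 hx
  simp
  field_simp

lemma hasFDerivAt_radialField {E : Type*} [NormedAddCommGroup E] [InnerProductSpace ℝ E] {x : E}
    (hx : x ≠ 0) {c : ℝ → ℝ} {c' : ℝ} (hc : HasDerivAt c c' ‖x‖) :
    HasFDerivAt (fun y : E => c ‖y‖ • y)
      (c ‖x‖ • ContinuousLinearMap.id ℝ E + (c' / ‖x‖) • InnerProductSpace.rankOne ℝ x x) x := by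
  have h1 := (hc.comp_hasFDerivAt x (hasFDerivAt_norm_of_ne hx)).smul (hasFDerivAt_id x)
  convert! h1 using 1
  ext1 h
  simp [smul_smul, div_eq_mul_inv, mul_assoc]

lemma hasFDerivAt_norm_rpow_smul {E : Type*} [NormedAddCommGroup E] [InnerProductSpace ℝ E] {x : E}
    (hx : x ≠ 0) (σ : ℝ) :
    HasFDerivAt (fun y : E => ‖y‖ ^ σ • y)
      (‖x‖ ^ σ • ContinuousLinearMap.id ℝ E +
        (σ * ‖x‖ ^ (σ - 2)) • InnerProductSpace.rankOne ℝ x x) x := by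
  have hx' : 0 < ‖x‖ := norm_pos_iff.2 hx
  have h1 := hasFDerivAt_radialField hx (Real.hasDerivAt_rpow_const (p := σ) (Or.inl hx'.ne'))
  convert! h1 using 3
  rw [mul_div_assoc, ← Real.rpow_sub_one hx'.ne']
  congr 2; ring

lemma gradient_eq_comp {n : ℕ} (u : Eucl n → ℝ) :
    gradient u = fun x => (InnerProductSpace.toDual ℝ (Eucl n)).symm (fderiv ℝ u x) := rfl

/-- The Hessian of a `C²` function as the derivative of its gradient. -/
lemma exists_hessian {n : ℕ} {u : Eucl n → ℝ} {x : Eucl n} (hu : ContDiffAt ℝ 2 u x) :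
    ∃ H : Eucl n →L[ℝ] Eucl n, HasFDerivAt (gradient u) H x ∧
      ∀ h k, inner ℝ (H h) k = inner ℝ h (H k) := by
  have h1 : DifferentiableAt ℝ (fderiv ℝ u) x :=
    (hu.fderiv_right (m := 1) (by norm_num)).differentiableAt (by norm_num)
  let L : (Eucl n →L[ℝ] ℝ) →L[ℝ] Eucl n := LinearMap.toContinuousLinearMap
    { toFun := (InnerProductSpace.toDual ℝ (Eucl n)).symm
      map_add' := map_add _
      map_smul' := fun c φ => by simp }
  have hL : ∀ (φ : Eucl n →L[ℝ] ℝ) k, inner ℝ (L φ) k = φ k := fun φ k =>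
    InnerProductSpace.toDual_symm_apply
  refine ⟨L.comp (fderiv ℝ (fderiv ℝ u) x), ?_, ?_⟩
  · rw [gradient_eq_comp]
    exact L.hasFDerivAt.comp x h1.hasFDerivAt
  · intro h k
    have hs := hu.isSymmSndFDerivAt (by simp) h k
    rw [real_inner_comm _ h]
    change inner ℝ (L _) k = inner ℝ (L _) h
    rw [hL, hL]
    exact hs

lemma hasDerivAt_comp_line {n : ℕ} {u : Eucl n → ℝ} {x h : Eucl n} {t : ℝ}
    (hu : DifferentiableAt ℝ u (x + t • h)) :
    HasDerivAt (fun s : ℝ => u (x + s • h)) (inner ℝ (gradient u (x + t • h)) h) t := by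
  have h1 : HasDerivAt (fun s : ℝ => x + s • h) h t := by
    simpa using ((hasDerivAt_id t).smul_const h).const_add x
  rw [inner_gradient_left]
  exact hu.hasFDerivAt.comp_hasDerivAt t h1

/-- If `c` were positive, the second derivative test would make `0` a local minimum too; then `ξ` is
constant nearby and `c = 0`. -/
lemma isLocalMax_second_deriv_nonpos {ξ ξ' : ℝ → ℝ} {c : ℝ}
    (h1 : ∀ᶠ t in 𝓝 0, HasDerivAt ξ (ξ' t) t) (h2 : HasDerivAt ξ' c 0) (hmax : IsLocalMax ξ 0) :
    ξ' 0 = 0 ∧ c ≤ 0 := by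
  have h0 : ξ' 0 = 0 := hmax.hasDerivAt_eq_zero h1.self_of_nhds
  refine ⟨h0, ?_⟩
  by_contra! hc
  have hd : deriv ξ =ᶠ[𝓝 0] ξ' := h1.mono fun t ht => ht.deriv
  have hdd : deriv (deriv ξ) 0 = c := by rw [hd.deriv_eq, h2.deriv]
  have hmin : IsLocalMin ξ 0 := isLocalMin_of_deriv_deriv_pos (by rw [hdd]; exact hc)
    (by rw [hd.self_of_nhds, h0]) h1.self_of_nhds.continuousAt
  have hconst : ξ =ᶠ[𝓝 0] fun _ => ξ 0 := by
    filter_upwards [hmin, hmax] with t ht ht'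
    exact le_antisymm ht' ht
  have : deriv (deriv ξ) 0 = 0 := by
    rw [hconst.deriv.deriv_eq]
    simp
  linarith

/-- Second order comparison of `u` with a radial function at a touching point. -/
lemma eigenvalue_le_of_isLocalMax {n : ℕ} {p : ℝ} (hp : 1 < p) {u : Eucl n → ℝ} {x : Eucl n}
    (hx : x ≠ 0) (hu : ContDiffAt ℝ 2 u x) {Θ Θ' ζ ζ' : ℝ → ℝ} {Θ₂ ζ₂ : ℝ}
    (hΘ : ∀ᶠ t in 𝓝 (u x), HasDerivAt Θ (Θ' t) t) (hΘ' : HasDerivAt Θ' Θ₂ (u x))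
    (hpos : 0 < Θ' (u x)) (hζ : ∀ᶠ r in 𝓝 ‖x‖, HasDerivAt ζ (ζ' r) r)
    (hζ' : HasDerivAt ζ' ζ₂ ‖x‖) (hmax : IsLocalMax (fun y => Θ (u y) - ζ ‖y‖) x) {d : ℝ}
    (hd : d = ζ' ‖x‖ / Θ' (u x)) (hd0 : d ≠ 0) :
    gradient u x = (d / ‖x‖) • x ∧
    ∀ lam, IsEigenvalueTuple (fderiv ℝ (pField p u) x) lam → ∃ i₀, ∀ i, lam i ≤
      Function.update (fun _ => |d| ^ (p - 2) * (d / ‖x‖)) i₀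
        (|d| ^ (p - 2) * (p - 1) * ((ζ₂ - Θ₂ * d ^ 2) / Θ' (u x))) i := by
  have hr : 0 < ‖x‖ := norm_pos_iff.2 hx
  set r := ‖x‖ with hr_def
  have hdζ : ζ' r = d * Θ' (u x) := by rw [hd]; field_simp
  obtain ⟨H, hH, hsymm⟩ := exists_hessian hu
  have hline : ∀ h : Eucl n, Tendsto (fun t : ℝ => x + t • h) (𝓝 0) (𝓝 x) := fun h => by
    have : Continuous (fun t : ℝ => x + t • h) := by fun_prop
    simpa using this.tendsto 0
  have hudiff : ∀ᶠ y in 𝓝 x, DifferentiableAt ℝ u y :=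
    (hu.eventually (by simp)).mono fun y hy => hy.differentiableAt (by norm_num)
  -- First and second order conditions at `t = 0` for the restriction to the line `x + t h`.
  have key : ∀ h : Eucl n, Θ' (u x) * inner ℝ (gradient u x) h = ζ' r * (inner ℝ x h / r) ∧
      Θ₂ * inner ℝ (gradient u x) h ^ 2 + Θ' (u x) * inner ℝ (H h) h -
        (ζ₂ * (inner ℝ x h / r) ^ 2 + ζ' r * ((‖h‖ ^ 2 - (inner ℝ x h / r) ^ 2) / r)) ≤ 0 := by
    intro h
    have hnorm : ∀ᶠ t in 𝓝 (0 : ℝ), HasDerivAt (fun s : ℝ => ‖x + s • h‖)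
        (inner ℝ (x + t • h) h / ‖x + t • h‖) t := by
      filter_upwards [(hline h).eventually (isOpen_ne.mem_nhds hx)] with t ht
      have h1 : HasDerivAt (fun s : ℝ => x + s • h) h t := by
        simpa using ((hasDerivAt_id t).smul_const h).const_add x
      have := (hasFDerivAt_norm_of_ne ht).comp_hasDerivAt t h1
      convert! this using 1
      rw [div_eq_inv_mul]
      rfl
    have hu0 : HasDerivAt (fun s : ℝ => u (x + s • h)) (inner ℝ (gradient u x) h) 0 := by
      simpa using hasDerivAt_comp_line (u := u) (x := x) (h := h) (t := 0)
        (by simpa using hudiff.self_of_nhds)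
    have hn0 : HasDerivAt (fun s : ℝ => ‖x + s • h‖) (inner ℝ x h / r) 0 := by
      simpa using hnorm.self_of_nhds
    have hl0 : HasDerivAt (fun s : ℝ => x + s • h) h 0 := by
      simpa using ((hasDerivAt_id (0 : ℝ)).smul_const h).const_add x
    have hξ : ∀ᶠ t in 𝓝 (0 : ℝ), HasDerivAt (fun s : ℝ => Θ (u (x + s • h)) - ζ ‖x + s • h‖)
        (Θ' (u (x + t • h)) * inner ℝ (gradient u (x + t • h)) h -
          ζ' ‖x + t • h‖ * (inner ℝ (x + t • h) h / ‖x + t • h‖)) t := by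
      have e1 : ∀ᶠ t in 𝓝 (0 : ℝ), HasDerivAt Θ (Θ' (u (x + t • h))) (u (x + t • h)) :=
        (hu.continuousAt.tendsto.comp (hline h)).eventually hΘ
      have e2 : ∀ᶠ t in 𝓝 (0 : ℝ), HasDerivAt ζ (ζ' ‖x + t • h‖) ‖x + t • h‖ :=
        (continuous_norm.continuousAt.tendsto.comp (hline h)).eventually hζ
      filter_upwards [e1, e2, hnorm, (hline h).eventually hudiff] with t h1 h2 h3 h4
      exact (h1.comp t (hasDerivAt_comp_line h4)).sub (h2.comp t h3)
    have hg : HasDerivAt (fun t : ℝ => inner ℝ (gradient u (x + t • h)) h)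
        (inner ℝ (H h) h) 0 := by
      have hH0 : HasFDerivAt (gradient u) H (x + (0 : ℝ) • h) := by simpa using hH
      simpa using (hH0.comp_hasDerivAt (0 : ℝ) hl0).inner ℝ (hasDerivAt_const (0 : ℝ) h)
    have hq : HasDerivAt (fun t : ℝ => inner ℝ (x + t • h) h / ‖x + t • h‖)
        ((‖h‖ ^ 2 * r - inner ℝ x h * (inner ℝ x h / r)) / r ^ 2) 0 := by
      have h1 : HasDerivAt (fun t : ℝ => inner ℝ (x + t • h) h) (‖h‖ ^ 2) 0 := by
        simpa [real_inner_self_eq_norm_sq] using hl0.inner ℝ (hasDerivAt_const (0 : ℝ) h)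
      simpa using h1.fun_div hn0 (by simpa using hx)
    have hΘ0 : HasDerivAt Θ' Θ₂ (u (x + (0 : ℝ) • h)) := by simpa using hΘ'
    have hζ0 : HasDerivAt ζ' ζ₂ ‖x + (0 : ℝ) • h‖ := by simpa using hζ'
    have hξ' := ((hΘ0.comp (0 : ℝ) hu0).mul hg).sub ((hζ0.comp (0 : ℝ) hn0).mul hq)
    have hm : IsLocalMax (fun s : ℝ => Θ (u (x + s • h)) - ζ ‖x + s • h‖) 0 := by
      have := (hline h).eventually hmax
      filter_upwards [this] with t ht
      simpa using ht
    obtain ⟨h1, h2⟩ := isLocalMax_second_deriv_nonpos hξ hξ' hm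
    simp only [Function.comp_apply, zero_smul, add_zero] at h1 h2
    refine ⟨by linarith, le_trans (le_of_eq ?_) h2⟩
    rw [← hr_def]
    field_simp
  -- To first order `u` agrees with the radial `v` defined by `Θ(v) = ζ`: `v' = d`, and
  -- differentiating once more gives `v'' = (ζ₂ - Θ₂ d²) / Θ'`, the radial entry of the bound.
  have hgrad : gradient u x = (d / r) • x := by
    refine ext_inner_right ℝ fun h => ?_
    have := (key h).1
    rw [hdζ] at this
    rw [inner_smul_left]
    have h2 : inner ℝ (gradient u x) h = d * (inner ℝ x h / r) := by
      have : Θ' (u x) * inner ℝ (gradient u x) h = Θ' (u x) * (d * (inner ℝ x h / r)) := by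
        rw [this]; ring
      exact mul_left_cancel₀ hpos.ne' this
    rw [h2]; simp; ring
  refine ⟨hgrad, fun lam hlam => ?_⟩
  set e : Eucl n := r⁻¹ • x with he_def
  have he : ‖e‖ = 1 := by rw [he_def, norm_smul, norm_inv, norm_norm, inv_mul_cancel₀ hr.ne']
  have hxe : x = r • e := by rw [he_def, smul_smul, mul_inv_cancel₀ hr.ne', one_smul]
  have hinner : ∀ h, inner ℝ x h / r = inner ℝ e h := fun h => by
    rw [he_def, inner_smul_left]; simp; ring
  have hge : gradient u x = d • e := by rw [hgrad, he_def, smul_smul]; rfl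
  have hc : 0 < |d| ^ (p - 2) := Real.rpow_pos_of_pos (abs_pos.2 hd0) _
  have hg0 : gradient u x ≠ 0 := by
    rw [hge]
    intro h0
    have := congrArg norm h0
    rw [norm_smul, he] at this
    simp [hd0] at this
  -- Chain rule at a nonzero gradient, with `Du = d e`.
  have hfd : HasFDerivAt (pField p u) ((|d| ^ (p - 2) • (ContinuousLinearMap.id ℝ (Eucl n) +
      (p - 2) • InnerProductSpace.rankOne ℝ e e)).comp H) x := by
    have h1 := (hasFDerivAt_norm_rpow_smul hg0 (p - 2)).comp x hH
    convert! h1 using 2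
    have hn : ‖gradient u x‖ = |d| := by rw [hge, norm_smul, he]; simp
    rw [hn, hge]
    ext1 y
    have hdd : |d| ^ (p - 2 - 2) * d ^ 2 = |d| ^ (p - 2) := by
      rw [← sq_abs, ← Real.rpow_natCast, ← Real.rpow_add (abs_pos.2 hd0)]
      congr 1; push_cast; ring
    simp only [smul_apply, add_apply, ContinuousLinearMap.id_apply,
      InnerProductSpace.rankOne_apply, smul_add, smul_smul, inner_smul_left]
    congr 2
    rw [← hdd]
    simp
    ring
  rw [hfd.fderiv] at hlam
  refine exists_eigenvalue_le hp hc he hsymm (fun h => ?_) hlam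
  have h2 := (key h).2
  rw [hge, inner_smul_left, hinner, hdζ] at h2
  simp only [RCLike.conj_to_real] at h2
  have h3 : inner ℝ (H h) h * Θ' (u x) ≤
      ((ζ₂ - Θ₂ * d ^ 2) / Θ' (u x) * inner ℝ e h ^ 2 +
        d / r * (‖h‖ ^ 2 - inner ℝ e h ^ 2)) * Θ' (u x) := by
    have : ((ζ₂ - Θ₂ * d ^ 2) / Θ' (u x) * inner ℝ e h ^ 2 +
        d / r * (‖h‖ ^ 2 - inner ℝ e h ^ 2)) * Θ' (u x) = (ζ₂ - Θ₂ * d ^ 2) * inner ℝ e h ^ 2 +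
        d * Θ' (u x) * ((‖h‖ ^ 2 - inner ℝ e h ^ 2) / r) := by field_simp
    rw [this]
    linarith
  exact le_of_mul_le_mul_right h3 hpos

/-! ### Consequences of a positive eigenvalue: growth and the maximum principle -/

/-- An eigenvalue tuple consists of eigenvalues. -/
lemma exists_eigenvector {n : ℕ} {A : Eucl n →L[ℝ] Eucl n} {lam : Fin n → ℝ}
    (hlam : IsEigenvalueTuple A lam) (i : Fin n) : ∃ h : Eucl n, ‖h‖ = 1 ∧ A h = lam i • h := by
  have hroot : (A : Eucl n →ₗ[ℝ] Eucl n).charpoly.IsRoot (lam i) := by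
    unfold IsEigenvalueTuple at hlam
    rw [hlam, Polynomial.IsRoot, Polynomial.eval_prod]
    exact Finset.prod_eq_zero (Finset.mem_univ i) (by simp)
  rw [← Module.End.hasEigenvalue_iff_isRoot_charpoly] at hroot
  obtain ⟨v, hv⟩ := hroot.exists_hasEigenvector
  have hv0 : ‖v‖ ≠ 0 := norm_ne_zero_iff.2 hv.2
  refine ⟨‖v‖⁻¹ • v, by rw [norm_smul, norm_inv, norm_norm, inv_mul_cancel₀ hv0], ?_⟩
  rw [map_smul, smul_comm]
  congr 1
  exact hv.apply_eq_smul

lemma norm_pField {n : ℕ} {p : ℝ} (hp : 1 < p) (u : Eucl n → ℝ) (x : Eucl n) :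
    ‖pField p u x‖ = ‖gradient u x‖ ^ (p - 1) := by
  rw [pField, norm_smul, Real.norm_of_nonneg (by positivity)]
  rcases eq_or_ne (gradient u x) 0 with h | h
  · rw [h, norm_zero, mul_zero, Real.zero_rpow (by linarith)]
  · have : 0 < ‖gradient u x‖ := norm_pos_iff.2 h
    rw [← Real.rpow_add_one this.ne']
    congr 1; ring

/-- At a point where `|Du|^{p-2}Du` has a positive eigenvalue and `Du = 0`, the function `u` grows
at least like the power `p/(p-1)` in some direction. -/
lemma not_flat_of_pos_eigenvalue {n : ℕ} {p : ℝ} (hp : 1 < p) {u : Eucl n → ℝ} {x : Eucl n}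
    (hu : ∀ᶠ y in 𝓝 x, DifferentiableAt ℝ u y) (hW : DifferentiableAt ℝ (pField p u) x)
    {lam : Fin n → ℝ} (hlam : IsEigenvalueTuple (fderiv ℝ (pField p u) x) lam)
    (hpos : ∃ i, 0 < lam i) {C κ : ℝ} (hκ : p / (p - 1) < κ)
    (hflat : ∀ᶠ y in 𝓝 x, u y - u x ≤ C * ‖y - x‖ ^ κ) : False := by
  have hp1 : 0 < p - 1 := by linarith
  set s := 1 / (p - 1) with hs
  have hs0 : 0 < s := by positivity
  have hsp : p / (p - 1) = s + 1 := by rw [hs]; field_simp; ring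
  rw [hsp] at hκ
  -- Since `κ > 1`, the term `C ‖y - x‖ ^ κ` has zero derivative at `x`, and `u` minus this term has
  -- a local maximum there.
  have hgrad : gradient u x = 0 := by
    have h1 : IsLocalMax (fun y => u y - C * ‖y - x‖ ^ κ) x := by
      filter_upwards [hflat] with y hy
      simp only [sub_self, norm_zero]
      rw [Real.zero_rpow (by linarith)]
      linarith
    have h2 : HasFDerivAt (fun y : Eucl n => ‖y - x‖ ^ κ) (0 : Eucl n →L[ℝ] ℝ) x := by
      have h3 := HasFDerivAt.comp (g := fun z : Eucl n => ‖z‖ ^ κ) (f := fun y => y - x) x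
        (hasFDerivAt_norm_rpow (x - x) (by linarith)) ((hasFDerivAt_id x).sub_const x)
      convert! h3 using 1
      simp
    have h3 := h1.hasFDerivAt_eq_zero (hu.self_of_nhds.hasFDerivAt.sub (h2.const_mul C))
    simp only [smul_zero, sub_zero] at h3
    rw [gradient_eq_comp]
    simp [h3]
  have hWx : pField p u x = 0 := by rw [pField, hgrad, smul_zero]
  obtain ⟨i, hi⟩ := hpos
  obtain ⟨h, hh, hAh⟩ := exists_eigenvector hlam i
  set l := lam i
  have hline : Tendsto (fun t : ℝ => x + t • h) (𝓝 0) (𝓝 x) := by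
    have : Continuous (fun t : ℝ => x + t • h) := by fun_prop
    simpa using this.tendsto 0
  -- Along the eigenvector the field is `t l h + o(t)`. An error of `l/3` keeps its direction close
  -- to `h` and its size comparable to `t l`; hence the slope of `u` along `h` is at least `c t ^
  -- s`.
  have hWl : ∀ᶠ t in 𝓝 (0 : ℝ), ‖pField p u (x + t • h) - (t * l) • h‖ ≤ l / 3 * |t| := by
    have hl0 : HasDerivAt (fun s : ℝ => x + s • h) h 0 := by
      simpa using ((hasDerivAt_id (0 : ℝ)).smul_const h).const_add x
    have hW0 : HasFDerivAt (pField p u) (fderiv ℝ (pField p u) x) (x + (0 : ℝ) • h) := by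
      simpa using hW.hasFDerivAt
    have hd := hW0.comp_hasDerivAt (0 : ℝ) hl0
    rw [hasDerivAt_iff_isLittleO] at hd
    filter_upwards [hd.def (by positivity : 0 < l / 3)] with t ht
    simpa [hWx, hAh, smul_smul] using ht
  set c := 1 / 3 * (l / 2) ^ s with hc
  have hc0 : 0 < c := by positivity
  have hder : ∀ᶠ t in 𝓝 (0 : ℝ), 0 < t → DifferentiableAt ℝ u (x + t • h) ∧
      c * t ^ s ≤ inner ℝ (gradient u (x + t • h)) h := by
    filter_upwards [hWl, hline.eventually hu] with t ht hut ht0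
    refine ⟨hut, ?_⟩
    set W := pField p u (x + t • h) with hWdef
    set g := gradient u (x + t • h) with hg
    rw [abs_of_pos ht0] at ht
    have hthl : ‖(t * l) • h‖ = t * l := by
      rw [norm_smul, hh, mul_one, Real.norm_of_nonneg (by positivity)]
    have h1 : ‖W‖ ≤ 4 / 3 * (t * l) := by
      have := norm_sub_norm_le W ((t * l) • h)
      linarith
    have h2 : 2 / 3 * (t * l) ≤ inner ℝ W h := by
      have h3 : inner ℝ W h = inner ℝ (W - (t * l) • h) h + t * l := by
        rw [inner_sub_left, inner_smul_left, real_inner_self_eq_norm_sq, hh]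
        simp
      have h4 := abs_real_inner_le_norm (W - (t * l) • h) h
      rw [hh, mul_one] at h4
      have := neg_abs_le (inner ℝ (W - (t * l) • h) h)
      linarith
    have h3 : 2 / 3 * (t * l) ≤ ‖W‖ := by
      have h4 := real_inner_le_norm W h
      rw [hh, mul_one] at h4
      linarith
    have hW0 : 0 < ‖W‖ := lt_of_lt_of_le (by positivity) h3
    have hnW : ‖W‖ = ‖g‖ ^ (p - 1) := norm_pField hp u _
    have hg0 : 0 < ‖g‖ := by
      rcases (norm_nonneg g).eq_or_lt with h0 | h0
      · rw [hnW, ← h0, Real.zero_rpow hp1.ne'] at hW0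
        exact absurd hW0 (lt_irrefl _)
      · exact h0
    have hgW : ‖g‖ = ‖W‖ ^ s := by
      rw [hnW, ← Real.rpow_mul hg0.le, hs, mul_one_div_cancel hp1.ne', Real.rpow_one]
    have hin : ‖g‖ ^ (p - 2) * inner ℝ g h = inner ℝ W h := by
      rw [hWdef, pField, inner_smul_left]; rfl
    have h5 : 1 / 3 * ‖g‖ ≤ inner ℝ g h := by
      have h6 : ‖g‖ ^ (p - 2) * (1 / 3 * ‖g‖) ≤ ‖g‖ ^ (p - 2) * inner ℝ g h := by
        rw [hin]
        have : ‖g‖ ^ (p - 2) * ‖g‖ = ‖W‖ := by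
          rw [hnW, ← Real.rpow_add_one hg0.ne']; congr 1; ring
        nlinarith
      exact le_of_mul_le_mul_left h6 (Real.rpow_pos_of_pos hg0 _)
    refine le_trans ?_ h5
    rw [hc, mul_assoc, ← Real.mul_rpow (by positivity) ht0.le, hgW]
    gcongr
    linarith
  obtain ⟨t₀, ht₀, hball⟩ := Metric.eventually_nhds_iff.1 hder
  have hu0 : DifferentiableAt ℝ u (x + (0 : ℝ) • h) := by simpa using hu.self_of_nhds
  -- Integrating the slope bound gives growth of order `t ^ (s + 1)` with `s + 1 = p/(p-1) < κ`,
  -- incompatible with flatness as `t → 0`.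
  have hmono : MonotoneOn (fun t : ℝ => u (x + t • h) - c / (s + 1) * t ^ (s + 1))
      (Set.Ico 0 t₀) := by
    have hd : ∀ t ∈ Set.Ico 0 t₀, HasDerivAt
        (fun t : ℝ => u (x + t • h) - c / (s + 1) * t ^ (s + 1))
        (inner ℝ (gradient u (x + t • h)) h - c * t ^ s) t := by
      intro t ht
      have h1 : DifferentiableAt ℝ u (x + t • h) := by
        rcases ht.1.eq_or_lt with h0 | h0
        · rw [← h0]; exact hu0
        · exact (hball (by rw [dist_zero_right, Real.norm_of_nonneg h0.le]; exact ht.2) h0).1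
      have h2 := (Real.hasDerivAt_rpow_const (x := t) (p := s + 1)
        (Or.inr (by linarith))).const_mul (c / (s + 1))
      convert! (hasDerivAt_comp_line h1).sub h2 using 1
      rw [add_sub_cancel_right]
      field_simp
    refine monotoneOn_of_deriv_nonneg (convex_Ico 0 t₀)
      (fun t ht => (hd t ht).continuousAt.continuousWithinAt)
      (fun t ht => (hd t (interior_subset ht)).differentiableAt.differentiableWithinAt) ?_
    intro t ht
    rw [interior_Ico] at ht
    rw [(hd t ⟨ht.1.le, ht.2⟩).deriv]
    have := (hball (y := t)
      (by rw [dist_zero_right, Real.norm_of_nonneg ht.1.le]; exact ht.2) ht.1).2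
    linarith
  have hgrow : ∀ᶠ t in 𝓝[>] (0 : ℝ), c / (s + 1) ≤ C * t ^ (κ - (s + 1)) := by
    have e1 : ∀ᶠ t in 𝓝[>] (0 : ℝ), u (x + t • h) - u x ≤ C * ‖x + t • h - x‖ ^ κ :=
      (hline.mono_left nhdsWithin_le_nhds).eventually hflat
    filter_upwards [e1, Ioo_mem_nhdsGT ht₀] with t h1 ht
    have h2 := hmono (a := 0) ⟨le_rfl, ht₀⟩ ⟨ht.1.le, ht.2⟩ ht.1.le
    simp only [zero_smul, add_zero] at h2
    rw [Real.zero_rpow (by linarith)] at h2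
    rw [add_sub_cancel_left, norm_smul, hh, mul_one, Real.norm_of_nonneg ht.1.le] at h1
    have h3 : c / (s + 1) * t ^ (s + 1) ≤ C * t ^ κ := by linarith
    have h4 : t ^ κ = t ^ (κ - (s + 1)) * t ^ (s + 1) := by
      rw [← Real.rpow_add ht.1]; congr 1; ring
    rw [h4, ← mul_assoc] at h3
    exact le_of_mul_le_mul_right h3 (Real.rpow_pos_of_pos ht.1 _)
  have hlim : Tendsto (fun t : ℝ => C * t ^ (κ - (s + 1))) (𝓝[>] 0) (𝓝 0) := by
    have h1 : Tendsto (fun t : ℝ => t ^ (κ - (s + 1))) (𝓝[>] 0) (𝓝 0) := by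
      have := (Real.continuousAt_rpow_const 0 (κ - (s + 1)) (Or.inr (by linarith))).tendsto
      rw [Real.zero_rpow (by linarith)] at this
      exact this.mono_left nhdsWithin_le_nhds
    simpa using h1.const_mul C
  have := ge_of_tendsto hlim hgrow
  have : 0 < c / (s + 1) := by positivity
  linarith

/-- Weak maximum principle, with a possible singularity at the origin. -/
lemma exists_sphere_forall_le {n : ℕ} (hn : 0 < n) {p : ℝ} (hp : 1 < p) {u : Eucl n → ℝ}
    (hu : Continuous u) (hu0 : DifferentiableAt ℝ u 0) (hu2 : ∀ x, x ≠ 0 → ContDiffAt ℝ 2 u x)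
    (hpos : ∀ x, x ≠ 0 → ∃ lam, IsEigenvalueTuple (fderiv ℝ (pField p u) x) lam ∧ ∃ i, 0 < lam i)
    {R : ℝ} (hR : 0 < R) : ∃ x, ‖x‖ = R ∧ ∀ y, ‖y‖ ≤ R → u y ≤ u x := by
  have : Nonempty (Fin n) := ⟨⟨0, hn⟩⟩
  have hsn : (Metric.sphere (0 : Eucl n) R).Nonempty :=
    NormedSpace.sphere_nonempty.2 hR.le
  obtain ⟨x₀, hx₀, hmax₀⟩ := (isCompact_sphere (0 : Eucl n) R).exists_isMaxOn hsn hu.continuousOn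
  refine ⟨x₀, by simpa using hx₀, fun y hy => ?_⟩
  by_contra! hlt
  -- The penalty `ε‖x‖` is at most half the gap on the ball, so the maximum of `u + ε‖x‖` stays off
  -- the sphere.
  set ε := (u y - u x₀) / (2 * R) with hε
  have hε0 : 0 < ε := div_pos (by linarith) (by linarith)
  have hεR : ε * R = (u y - u x₀) / 2 := by rw [hε]; field_simp
  obtain ⟨x₁, hx₁, hmax⟩ := (isCompact_closedBall (0 : Eucl n) R).exists_isMaxOn
    ⟨y, by simpa using hy⟩ (f := fun x => u x + ε * ‖x‖) (by fun_prop)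
  have hx₁R : ‖x₁‖ ≤ R := by simpa using hx₁
  have hle : ∀ x, ‖x‖ ≤ R → u x + ε * ‖x‖ ≤ u x₁ + ε * ‖x₁‖ := fun x hx =>
    hmax (by simpa using hx)
  have hlt₁ : ‖x₁‖ < R := by
    refine lt_of_le_of_ne hx₁R fun h => ?_
    have h1 : u x₁ ≤ u x₀ := hmax₀ (by simpa using h)
    have h2 := hle y hy
    have h3 : 0 ≤ ε * ‖y‖ := by positivity
    rw [h, hεR] at h2
    linarith
  have hnear : ∀ᶠ x in 𝓝 x₁, u x + ε * ‖x‖ ≤ u x₁ + ε * ‖x₁‖ := by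
    have : ∀ᶠ x in 𝓝 x₁, ‖x‖ < R := continuous_norm.continuousAt.eventually (gt_mem_nhds hlt₁)
    exact this.mono fun x hx => hle x hx.le
  rcases eq_or_ne x₁ 0 with rfl | hne
  -- Nothing is known about the matrix at the origin. There `u - u 0` is `o(‖x‖)` by
  -- differentiability and criticality, but the maximum forces it to be at most `-ε‖x‖`.
  · have hloc : IsLocalMax u 0 := by
      filter_upwards [hnear] with x hx
      have : 0 ≤ ε * ‖x‖ := by positivity
      simp only [norm_zero, mul_zero, add_zero] at hx
      linarith
    have hd := hu0.hasFDerivAt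
    rw [hloc.hasFDerivAt_eq_zero hd, hasFDerivAt_iff_isLittleO] at hd
    have h1 := hd.def (half_pos hε0)
    obtain ⟨r, hr, hball⟩ := Metric.eventually_nhds_iff.1 (h1.and hnear)
    obtain ⟨z, hz⟩ := (NormedSpace.sphere_nonempty (E := Eucl n) (x := 0) (r := r / 2)).2
      (by positivity)
    have hzn : ‖z‖ = r / 2 := by simpa using hz
    obtain ⟨h2, h3⟩ := hball (y := z) (by rw [dist_zero_right, hzn]; linarith)
    simp only [norm_zero, mul_zero, add_zero, sub_zero, zero_apply, hzn, Real.norm_eq_abs] at h2 h3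
    have := neg_abs_le (u z - u 0)
    nlinarith
  -- Off the origin `u` is touched by `-ε‖x‖` plus a constant, whose radial second derivative is
  -- zero and whose tangential ones are negative; no eigenvalue can then be positive.
  · have hloc : IsLocalMax (fun x => id (u x) - (-ε) * ‖x‖) x₁ := by
      filter_upwards [hnear] with x hx
      simp only [id]
      linarith
    have hr : 0 < ‖x₁‖ := norm_pos_iff.2 hne
    obtain ⟨-, h⟩ := eigenvalue_le_of_isLocalMax hp hne (hu2 x₁ hne) (Θ := id) (Θ' := fun _ => 1)
      (Θ₂ := 0) (ζ := fun r => (-ε) * r) (ζ' := fun _ => -ε) (ζ₂ := 0) (d := -ε)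
      (Eventually.of_forall fun t => hasDerivAt_id t) (hasDerivAt_const _ _) one_pos
      (Eventually.of_forall fun t => by simpa using (hasDerivAt_id t).const_mul (-ε))
      (hasDerivAt_const _ _) hloc (by simp) (by linarith)
    obtain ⟨lam, hlam, i, hi⟩ := hpos x₁ hne
    obtain ⟨i₀, hi₀⟩ := h lam hlam
    have h2 := hi₀ i
    have h3 : 0 < |(-ε)| ^ (p - 2) := Real.rpow_pos_of_pos (abs_pos.2 (by linarith)) _
    rcases eq_or_ne i i₀ with rfl | hii
    · simp at h2
      linarith
    · rw [Function.update_of_ne hii] at h2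
      have : -ε / ‖x₁‖ < 0 := div_neg_of_neg_of_pos (by linarith) hr
      nlinarith

/-! ### The primitive of f^(n/k) and the Keller–Osserman integral -/

/-- A `C¹` primitive of `g`, up to a constant, on `[a + 1, ∞)`, which is `1` on `(-∞, a]`. -/
noncomputable def cutoffPrimitive (g : ℝ → ℝ) (a t : ℝ) : ℝ :=
  1 + ∫ s in a..t, max 0 (min 1 (s - a)) * g s

section cutoffPrimitive

variable {g : ℝ → ℝ}

lemma continuous_cutoff_mul (hg : Continuous g) (a : ℝ) :
    Continuous fun s => max 0 (min 1 (s - a)) * g s := by fun_prop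

lemma hasDerivAt_cutoffPrimitive (hg : Continuous g) (a t : ℝ) :
    HasDerivAt (cutoffPrimitive g a) (max 0 (min 1 (t - a)) * g t) t :=
  ((continuous_cutoff_mul hg a).integral_hasStrictDerivAt a t).hasDerivAt.const_add 1

lemma contDiff_cutoffPrimitive (hg : Continuous g) (a : ℝ) :
    ContDiff ℝ 1 (cutoffPrimitive g a) := by
  rw [contDiff_one_iff_deriv]
  refine ⟨fun t => (hasDerivAt_cutoffPrimitive hg a t).differentiableAt, ?_⟩
  rw [funext fun t => (hasDerivAt_cutoffPrimitive hg a t).deriv]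
  exact continuous_cutoff_mul hg a

lemma cutoffPrimitive_self (a : ℝ) : cutoffPrimitive g a a = 1 := by simp [cutoffPrimitive]

lemma monotone_cutoffPrimitive (hg : Continuous g) (hpos : ∀ t, 0 < g t) (a : ℝ) :
    Monotone (cutoffPrimitive g a) :=
  monotone_of_deriv_nonneg (fun t => (hasDerivAt_cutoffPrimitive hg a t).differentiableAt)
    fun t => by
      rw [(hasDerivAt_cutoffPrimitive hg a t).deriv]
      exact mul_nonneg (le_max_left _ _) (hpos t).le

/-- The reason for the cutoff: real powers of the primitive are defined and as smooth as the
primitive on all of `ℝ`, whereas `∫₀ᵗ g` is negative for `t < 0`. -/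
lemma one_le_cutoffPrimitive (hg : Continuous g) (hpos : ∀ t, 0 < g t) (a t : ℝ) :
    1 ≤ cutoffPrimitive g a t := by
  rcases le_total a t with h | h
  · rw [← cutoffPrimitive_self (g := g) a]
    exact monotone_cutoffPrimitive hg hpos a h
  · have h0 : ∫ s in a..t, max 0 (min 1 (s - a)) * g s = ∫ s in a..t, (0 : ℝ) := by
      refine intervalIntegral.integral_congr fun s hs => ?_
      rw [Set.uIcc_of_ge h] at hs
      have : min 1 (s - a) ≤ 0 := (min_le_right _ _).trans (by linarith [hs.2])
      simp [max_eq_left this]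
    rw [cutoffPrimitive, h0]
    simp

lemma cutoff_mul_le (hpos : ∀ t, 0 < g t) (a t : ℝ) : max 0 (min 1 (t - a)) * g t ≤ g t := by
  have : max 0 (min 1 (t - a)) ≤ 1 := max_le zero_le_one (min_le_left _ _)
  nlinarith [hpos t]

lemma cutoffPrimitive_le (hg : Continuous g) (hpos : ∀ t, 0 < g t) (hmono : Monotone g)
    {a t : ℝ} (h : a ≤ t) : cutoffPrimitive g a t ≤ 1 + (t - a) * g t := by
  have h1 : ∫ s in a..t, max 0 (min 1 (s - a)) * g s ≤ ∫ s in a..t, g t := by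
    refine intervalIntegral.integral_mono_on h
      ((continuous_cutoff_mul hg a).intervalIntegrable _ _) (by simp) fun s hs => ?_
    exact (cutoff_mul_le hpos a s).trans (hmono hs.2)
  rw [intervalIntegral.integral_const, smul_eq_mul] at h1
  rw [cutoffPrimitive]
  linarith

/-- Beyond `a + 1` the cutoff factor is `1`. A bounded difference from `∫₀ᵗ g` does not affect
convergence of the Keller–Osserman integral. -/
lemma exists_cutoffPrimitive_eq (hg : Continuous g) (a : ℝ) :
    ∃ C, ∀ t, a + 1 ≤ t → cutoffPrimitive g a t = C + ∫ s in (0 : ℝ)..t, g s := by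
  refine ⟨cutoffPrimitive g a (a + 1) - ∫ s in (0 : ℝ)..(a + 1), g s, fun t ht => ?_⟩
  have hi : ∀ x y, IntervalIntegrable (fun s => max 0 (min 1 (s - a)) * g s) volume x y :=
    fun x y => (continuous_cutoff_mul hg a).intervalIntegrable x y
  have hi' : ∀ x y, IntervalIntegrable g volume x y := fun x y => hg.intervalIntegrable x y
  have h1 := intervalIntegral.integral_add_adjacent_intervals (hi a (a + 1)) (hi (a + 1) t)
  have h2 := intervalIntegral.integral_add_adjacent_intervals (hi' 0 (a + 1)) (hi' (a + 1) t)
  have h3 : ∫ s in (a + 1)..t, max 0 (min 1 (s - a)) * g s = ∫ s in (a + 1)..t, g s := by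
    refine intervalIntegral.integral_congr fun s hs => ?_
    rw [Set.uIcc_of_le ht] at hs
    have : (1 : ℝ) ≤ s - a := by linarith [hs.1]
    simp [min_eq_left this]
  rw [cutoffPrimitive, cutoffPrimitive, ← h1, ← h2, h3]
  ring

lemma integral_pos_of_pos (hg : Continuous g) (hpos : ∀ t, 0 < g t) {t : ℝ} (ht : 0 < t) :
    0 < ∫ s in (0 : ℝ)..t, g s :=
  intervalIntegral.intervalIntegral_pos_of_pos (hg.intervalIntegrable _ _) hpos ht

lemma continuous_cutoffPrimitive_rpow (hg : Continuous g) (hpos : ∀ t, 0 < g t) (a r : ℝ) :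
    Continuous fun t => cutoffPrimitive g a t ^ r :=
  (contDiff_cutoffPrimitive hg a).continuous.rpow_const fun t =>
    Or.inl (by linarith [one_le_cutoffPrimitive hg hpos a t])

lemma measurable_ofReal_integral_rpow (hg : Continuous g) (r : ℝ) :
    Measurable fun t : ℝ => (∫ s in (0 : ℝ)..t, g s) ^ r := by
  have : Continuous fun t : ℝ => ∫ s in (0 : ℝ)..t, g s :=
    intervalIntegral.continuous_primitive (fun x y => hg.intervalIntegrable x y) 0
  exact this.measurable.pow_const r

lemma integrableOn_cutoffPrimitive (hg : Continuous g) (hpos : ∀ t, 0 < g t) {N : ℝ} (hN : 0 < N)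
    {c : ℝ} (hc : 0 < c)
    (h : ∫⁻ t in Set.Ioi c, ENNReal.ofReal ((∫ s in (0 : ℝ)..t, g s) ^ (-(1 / N))) ≠ ⊤) (a : ℝ) :
    IntegrableOn (fun t => cutoffPrimitive g a t ^ (-(1 / N))) (Set.Ioi a) := by
  obtain ⟨C, hC⟩ := exists_cutoffPrimitive_eq hg a
  set T := max c (a + 1) with hT
  have haT : a ≤ T := (by linarith : a ≤ a + 1).trans (le_max_right _ _)
  have hI : IntegrableOn (fun t => (∫ s in (0 : ℝ)..t, g s) ^ (-(1 / N))) (Set.Ioi c) := by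
    refine ⟨(measurable_ofReal_integral_rpow hg _).aestronglyMeasurable, ?_⟩
    rw [hasFiniteIntegral_iff_ofReal]
    · exact lt_top_iff_ne_top.2 h
    · refine (ae_restrict_iff' measurableSet_Ioi).2 (Eventually.of_forall fun t ht => ?_)
      exact Real.rpow_nonneg (integral_pos_of_pos hg hpos (hc.trans ht)).le _
  have hcont := continuous_cutoffPrimitive_rpow hg hpos a (-(1 / N))
  rw [← Set.Ioc_union_Ioi_eq_Ioi haT]
  refine IntegrableOn.union (hcont.integrableOn_Icc.mono_set Set.Ioc_subset_Icc_self) ?_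
  have hI' := ((hI.mono_set (Set.Ioi_subset_Ioi (le_max_left c (a + 1)))).const_mul
    ((1 / (1 + |C|)) ^ (-(1 / N))))
  refine Integrable.mono' hI' hcont.aestronglyMeasurable ?_
  refine (ae_restrict_iff' measurableSet_Ioi).2 (Eventually.of_forall fun t ht => ?_)
  have ht' : T < t := ht
  have h1 : 0 < ∫ s in (0 : ℝ)..t, g s :=
    integral_pos_of_pos hg hpos (hc.trans ((le_max_left _ _).trans_lt ht'))
  have h2 := hC t ((le_max_right c (a + 1)).trans ht'.le)
  have h3 := one_le_cutoffPrimitive hg hpos a t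
  -- As the cutoff primitive is at least `1`, the constant `|C|` is at most `|C|` times it.
  have h4 : 1 / (1 + |C|) * ∫ s in (0 : ℝ)..t, g s ≤ cutoffPrimitive g a t := by
    rw [div_mul_eq_mul_div, one_mul, div_le_iff₀ (by positivity)]
    nlinarith [neg_abs_le C, abs_nonneg C]
  rw [Real.norm_of_nonneg (by positivity), ← Real.mul_rpow (by positivity) h1.le]
  exact Real.rpow_le_rpow_of_nonpos (by positivity) h4 (by
    have : 0 < 1 / N := by positivity
    linarith)

lemma lintegral_ne_top_of_integrableOn_cutoffPrimitive (hg : Continuous g) (hpos : ∀ t, 0 < g t)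
    {N : ℝ} (hN : 0 < N)
    (h : IntegrableOn (fun t => cutoffPrimitive g 0 t ^ (-(1 / N))) (Set.Ioi 1)) :
    ∫⁻ t in Set.Ioi (1 : ℝ), ENNReal.ofReal ((∫ s in (0 : ℝ)..t, g s) ^ (-(1 / N))) ≠ ⊤ := by
  obtain ⟨C, hC⟩ := exists_cutoffPrimitive_eq hg 0
  have h1 : 0 < ∫ s in (0 : ℝ)..1, g s := integral_pos_of_pos hg hpos one_pos
  set F₁ := ∫ s in (0 : ℝ)..1, g s
  set D := 1 + |C| / F₁ with hD
  have hD0 : 0 < D := by positivity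
  have hI : IntegrableOn (fun t => (∫ s in (0 : ℝ)..t, g s) ^ (-(1 / N))) (Set.Ioi 1) := by
    refine Integrable.mono' (h.const_mul ((1 / D) ^ (-(1 / N))))
      (measurable_ofReal_integral_rpow hg _).aestronglyMeasurable ?_
    refine (ae_restrict_iff' measurableSet_Ioi).2 (Eventually.of_forall fun t ht => ?_)
    have ht' : (1 : ℝ) < t := ht
    have h2 : F₁ ≤ ∫ s in (0 : ℝ)..t, g s := by
      have := intervalIntegral.integral_add_adjacent_intervals
        (hg.intervalIntegrable (μ := volume) 0 1) (hg.intervalIntegrable 1 t)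
      rw [← this]
      have := intervalIntegral.integral_nonneg (μ := volume) ht'.le (fun s _ => (hpos s).le)
      linarith
    have h3 := hC t (by linarith)
    have h4 := one_le_cutoffPrimitive hg hpos 0 t
    -- For `t > 1` the ordinary primitive is at least `F₁`, so `|C|` is at most `|C| / F₁` times it.
    have h5 : 1 / D * cutoffPrimitive g 0 t ≤ ∫ s in (0 : ℝ)..t, g s := by
      rw [div_mul_eq_mul_div, one_mul, div_le_iff₀ hD0, h3, hD]
      have h6 : |C| ≤ (∫ s in (0 : ℝ)..t, g s) * (|C| / F₁) := by
        rw [mul_div_assoc', le_div_iff₀ h1]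
        nlinarith [abs_nonneg C]
      nlinarith [le_abs_self C]
    rw [Real.norm_of_nonneg (Real.rpow_nonneg (by linarith) _),
      ← Real.mul_rpow (by positivity) (by linarith)]
    exact Real.rpow_le_rpow_of_nonpos (by positivity) h5 (by
      have : 0 < 1 / N := by positivity
      linarith)
  have := hI.2
  rw [hasFiniteIntegral_iff_ofReal] at this
  · exact this.ne
  · refine (ae_restrict_iff' measurableSet_Ioi).2 (Eventually.of_forall fun t ht => ?_)
    exact Real.rpow_nonneg (integral_pos_of_pos hg hpos (one_pos.trans ht)).le _

lemma exists_integral_lt (hg : Continuous g) (hpos : ∀ t, 0 < g t) {N a : ℝ}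
    (h : IntegrableOn (fun t => cutoffPrimitive g a t ^ (-(1 / N))) (Set.Ioi a)) :
    ∃ L, 0 < L ∧ ∀ t, ∫ s in a..t, cutoffPrimitive g a s ^ (-(1 / N)) < L := by
  have hnn : ∀ s, 0 ≤ cutoffPrimitive g a s ^ (-(1 / N)) := fun s =>
    Real.rpow_nonneg (by linarith [one_le_cutoffPrimitive hg hpos a s]) _
  have h0 : 0 ≤ ∫ s in Set.Ioi a, cutoffPrimitive g a s ^ (-(1 / N)) :=
    integral_nonneg hnn
  refine ⟨(∫ s in Set.Ioi a, cutoffPrimitive g a s ^ (-(1 / N))) + 1, by linarith, fun t => ?_⟩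
  rcases le_total a t with hat | hat
  · rw [intervalIntegral.integral_of_le hat]
    have := setIntegral_mono_set h (Eventually.of_forall hnn)
      (Set.Ioc_subset_Ioi_self : Set.Ioc a t ⊆ Set.Ioi a).eventuallyLE
    linarith
  · rw [intervalIntegral.integral_of_ge hat]
    have : 0 ≤ ∫ s in Set.Ioc t a, cutoffPrimitive g a s ^ (-(1 / N)) := integral_nonneg hnn
    linarith

lemma tendsto_integral_atTop (hg : Continuous g) (hpos : ∀ t, 0 < g t) {N : ℝ}
    (h : ¬ IntegrableOn (fun t => cutoffPrimitive g 0 t ^ (-(1 / N))) (Set.Ioi 1)) :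
    Tendsto (fun t => ∫ s in (1 : ℝ)..t, cutoffPrimitive g 0 s ^ (-(1 / N))) atTop atTop := by
  have hcont := continuous_cutoffPrimitive_rpow hg hpos 0 (-(1 / N))
  have hnn : ∀ s, 0 ≤ cutoffPrimitive g 0 s ^ (-(1 / N)) := fun s =>
    Real.rpow_nonneg (by linarith [one_le_cutoffPrimitive hg hpos 0 s]) _
  have hmono : Monotone fun t => ∫ s in (1 : ℝ)..t, cutoffPrimitive g 0 s ^ (-(1 / N)) :=
    monotone_of_deriv_nonneg
      (fun t => (hcont.integral_hasStrictDerivAt 1 t).hasDerivAt.differentiableAt)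
      fun t => by rw [(hcont.integral_hasStrictDerivAt 1 t).hasDerivAt.deriv]; exact hnn t
  rcases tendsto_atTop_of_monotone hmono with h1 | ⟨l, hl⟩
  · exact h1
  · refine absurd ?_ h
    refine integrableOn_Ioi_of_intervalIntegral_norm_tendsto l 1 (b := id) (l := atTop)
      (fun t => hcont.integrableOn_Icc.mono_set Set.Ioc_subset_Icc_self) tendsto_id ?_
    simp only [Real.norm_of_nonneg (hnn _)]
    exact hl

/-- The integrand is `1` on `(-∞, 0]`, so backward in time the autonomous equation never blows up.
-/
lemma tendsto_integral_atBot (hg : Continuous g) (hpos : ∀ t, 0 < g t) {N : ℝ} :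
    Tendsto (fun t => ∫ s in (1 : ℝ)..t, cutoffPrimitive g 0 s ^ (-(1 / N))) atBot atBot := by
  have hcont := continuous_cutoffPrimitive_rpow hg hpos 0 (-(1 / N))
  have hlow : ∀ t ≤ 0, cutoffPrimitive g 0 t ^ (-(1 / N)) = 1 := fun t ht => by
    have h1 : cutoffPrimitive g 0 t = 1 :=
      le_antisymm (by simpa [cutoffPrimitive_self] using monotone_cutoffPrimitive hg hpos 0 ht)
        (one_le_cutoffPrimitive hg hpos 0 t)
    rw [h1, Real.one_rpow]
  have heq : ∀ t ≤ 0, ∫ s in (1 : ℝ)..t, cutoffPrimitive g 0 s ^ (-(1 / N)) =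
      (∫ s in (1 : ℝ)..0, cutoffPrimitive g 0 s ^ (-(1 / N))) + t := fun t ht => by
    rw [← intervalIntegral.integral_add_adjacent_intervals (hcont.intervalIntegrable 1 0)
      (hcont.intervalIntegrable 0 t)]
    congr 1
    rw [intervalIntegral.integral_congr (g := fun _ => (1 : ℝ))]
    · simp
    · intro s hs
      rw [Set.uIcc_of_ge ht] at hs
      exact hlow s hs.2
  refine (tendsto_atBot_add_const_left atBot
    (∫ s in (1 : ℝ)..0, cutoffPrimitive g 0 s ^ (-(1 / N))) tendsto_id).congr' ?_
  filter_upwards [eventually_le_atBot 0] with t ht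
  exact (heq t ht).symm

/-- Differentiate `w ^ N = F`. The product `w ^ (N - 1) * w'` is the form in which second
derivatives enter the radial inequality. -/
lemma hasDerivAt_cutoffPrimitive_rpow (hg : Continuous g) (hpos : ∀ t, 0 < g t) {N : ℝ}
    (hN : 0 < N) (a t : ℝ) :
    ∃ w', HasDerivAt (fun t => cutoffPrimitive g a t ^ (1 / N)) w' t ∧ 0 ≤ w' ∧
      (cutoffPrimitive g a t ^ (1 / N)) ^ (N - 1) * w' = max 0 (min 1 (t - a)) * g t / N := by
  have h1 : 0 < cutoffPrimitive g a t := by linarith [one_le_cutoffPrimitive hg hpos a t]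
  refine ⟨_, (hasDerivAt_cutoffPrimitive hg a t).rpow_const (Or.inl h1.ne'), ?_, ?_⟩
  · have := (hpos t).le
    positivity
  · have : (cutoffPrimitive g a t ^ (1 / N)) ^ (N - 1) * cutoffPrimitive g a t ^ (1 / N - 1) = 1 := by
      rw [← Real.rpow_mul h1.le, ← Real.rpow_add h1]
      have : 1 / N * (N - 1) + (1 / N - 1) = 0 := by field_simp; ring
      rw [this, Real.rpow_zero]
    calc _ = ((cutoffPrimitive g a t ^ (1 / N)) ^ (N - 1) * cutoffPrimitive g a t ^ (1 / N - 1)) *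
          (max 0 (min 1 (t - a)) * g t * (1 / N)) := by ring
      _ = _ := by rw [this]; ring

/-- If the Keller–Osserman integral converges, the `(N-1)/N`-th power of the primitive of `g` is
controlled by `g` itself. -/
lemma exists_cutoffPrimitive_rpow_le (hg : Continuous g) (hpos : ∀ t, 0 < g t) (hmono : Monotone g)
    {N a L : ℝ} (hN : 0 < N) (hL0 : 0 < L)
    (hL : ∀ t, ∫ s in a..t, cutoffPrimitive g a s ^ (-(1 / N)) < L) :
    ∃ C, 0 < C ∧ ∀ t, a ≤ t → (cutoffPrimitive g a t ^ (1 / N)) ^ (N - 1) ≤ C * g t := by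
  have hcont := continuous_cutoffPrimitive_rpow hg hpos a (-(1 / N))
  refine ⟨1 / g a + L, by have := hpos a; positivity, fun t hat => ?_⟩
  have hF := one_le_cutoffPrimitive hg hpos a t
  set F := cutoffPrimitive g a t
  set w := F ^ (1 / N) with hw
  have hw1 : 1 ≤ w := Real.one_le_rpow hF (by positivity)
  -- The integrand `1/w` is non-increasing, so `(t - a) / w t` is at most its integral, hence below
  -- `L`.
  have hta : t - a ≤ L * w := by
    have h1 : ∫ s in a..t, F ^ (-(1 / N)) ≤ ∫ s in a..t, cutoffPrimitive g a s ^ (-(1 / N)) := by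
      refine intervalIntegral.integral_mono_on hat (by simp) (hcont.intervalIntegrable _ _)
        fun s hs => ?_
      exact Real.rpow_le_rpow_of_nonpos (by linarith [one_le_cutoffPrimitive hg hpos a s])
        (monotone_cutoffPrimitive hg hpos a hs.2) (by
          have : 0 < 1 / N := by positivity
          linarith)
    rw [intervalIntegral.integral_const, smul_eq_mul, Real.rpow_neg (by linarith)] at h1
    have h2 := h1.trans (hL t).le
    rwa [← div_eq_mul_inv, div_le_iff₀ (by positivity)] at h2
  have hwN : w ^ (N - 1) * w = F := by
    rw [← Real.rpow_add_one (by positivity), sub_add_cancel, hw, ← Real.rpow_mul (by linarith),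
      one_div_mul_cancel hN.ne', Real.rpow_one]
  have h3 : F ≤ 1 + (t - a) * g t := cutoffPrimitive_le hg hpos hmono hat
  have h4 : (t - a) * g t ≤ L * w * g t := mul_le_mul_of_nonneg_right hta (hpos t).le
  have h5 : 1 ≤ 1 / g a * g t := by
    rw [div_mul_eq_mul_div, one_mul, le_div_iff₀ (hpos a), one_mul]
    exact hmono hat
  -- Monotonicity gave `F ≤ 1 + (t - a) g t`; with `t - a ≤ L w` and `w ≥ 1` one factor `w` cancels.
  have h6 : w ^ (N - 1) * w ≤ ((1 / g a + L) * g t) * w := by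
    rw [hwN]
    nlinarith
  exact le_of_mul_le_mul_right h6 (by linarith)

end cutoffPrimitive

/-! ### The radial inequality and the necessity of the Keller–Osserman condition -/

/-- The equation for the radial eigenvalues `(p-1) d^{p-2} b, d^{p-1}/r, …, d^{p-1}/r`. -/
lemma le_PiK_update_iff {n k : ℕ} (hk : 1 ≤ k) (hkn : k ≤ n) {p α β r d b F : ℝ} (i₀ : Fin n)
    (hr : 0 < r) (hd : 0 < d) (hF : 0 < F) (h : 0 ≤ (p - 1) * b + (k - 1) * (d / r)) :
    r ^ α * d ^ β * F ≤ (PiK k (Function.update (fun _ => d ^ (p - 2) * (d / r)) i₀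
        (d ^ (p - 2) * (p - 1) * b))) ^ (1 / (n.choose k : ℝ)) ↔
      r ^ (α * ((n : ℝ) / k) + (n : ℝ) / k - 1) * F ^ ((n : ℝ) / k) ≤
        (k : ℝ) ^ ((n : ℝ) / k - 1) * d ^ ((n : ℝ) * (p - β - 1) / k - 1) *
          ((p - 1) * b + (k - 1) * (d / r)) := by
  have hk0 : (0 : ℝ) < k := by positivity
  have hn0 : (0 : ℝ) < n := hk0.trans_le (by exact_mod_cast hkn)
  have hν : 0 < (n : ℝ) / k := by positivity
  have hdp : 0 < d ^ (p - 2) := Real.rpow_pos_of_pos hd _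
  have hB : 0 ≤ d ^ (p - 2) * (d / r) := by positivity
  have hAB : 0 ≤ d ^ (p - 2) * (p - 1) * b + (k - 1) * (d ^ (p - 2) * (d / r)) := by
    have := mul_nonneg hdp.le h
    linarith
  have hPi : 0 ≤ PiK k (Function.update (fun _ => d ^ (p - 2) * (d / r)) i₀
      (d ^ (p - 2) * (p - 1) * b)) := by
    rw [PiK_update hk]; positivity
  have hq : (n : ℝ) * (p - β - 1) / k = n / k * (p - β - 1) := by ring
  -- The power `n/k` undoes the exponent `k/n` of the factor that contains `b`.
  rw [← Real.rpow_le_rpow_iff (by positivity) (Real.rpow_nonneg hPi _) hν,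
    PiK_update_rpow_rpow hk hkn i₀ hB hAB, hq]
  set ν := (n : ℝ) / k
  rw [Real.mul_rpow (by positivity) hF.le, Real.mul_rpow (by positivity) (by positivity),
    ← Real.rpow_mul hr.le, ← Real.rpow_mul hd.le]
  have e1 : (k * (d ^ (p - 2) * (d / r))) ^ (ν - 1) =
      (k : ℝ) ^ (ν - 1) * d ^ ((p - 1) * (ν - 1)) * (r ^ (ν - 1))⁻¹ := by
    have : d ^ (p - 2) * (d / r) = d ^ (p - 1) / r := by
      rw [mul_div_assoc', ← Real.rpow_add_one hd.ne']
      congr 2; ring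
    rw [this, Real.mul_rpow hk0.le (by positivity), Real.div_rpow (by positivity) hr.le,
      ← Real.rpow_mul hd.le]
    ring
  have e2 : d ^ (p - 2) * (p - 1) * b + (k - 1) * (d ^ (p - 2) * (d / r)) =
      d ^ (p - 2) * ((p - 1) * b + (k - 1) * (d / r)) := by ring
  have e3 : r ^ (α * ν + ν - 1) = r ^ (α * ν) * r ^ (ν - 1) := by
    rw [← Real.rpow_add hr]; congr 1; ring
  have e4 : d ^ (p - 2) * d ^ ((p - 1) * (ν - 1)) = d ^ (β * ν) * d ^ (ν * (p - β - 1) - 1) := by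
    rw [← Real.rpow_add hd, ← Real.rpow_add hd]; congr 1; ring
  rw [e1, e2, e3]
  set X := (p - 1) * b + (k - 1) * (d / r)
  have hrν : 0 < r ^ (ν - 1) := Real.rpow_pos_of_pos hr _
  have hdβ : 0 < d ^ (β * ν) := Real.rpow_pos_of_pos hd _
  have e5 : d ^ (p - 2) * X * ((k : ℝ) ^ (ν - 1) * d ^ ((p - 1) * (ν - 1)) * (r ^ (ν - 1))⁻¹) =
      (d ^ (β * ν) * ((k : ℝ) ^ (ν - 1) * d ^ (ν * (p - β - 1) - 1) * X)) / r ^ (ν - 1) := by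
    rw [div_eq_mul_inv]
    linear_combination X * (k : ℝ) ^ (ν - 1) * (r ^ (ν - 1))⁻¹ * e4
  rw [e5, le_div_iff₀ hrν, show r ^ (α * ν) * d ^ (β * ν) * F ^ ν * r ^ (ν - 1) =
    d ^ (β * ν) * (r ^ (α * ν) * r ^ (ν - 1) * F ^ ν) by ring, mul_le_mul_iff_right₀ hdβ]

lemma hasDerivAt_scaled_rpow (L κ R : ℝ) {r : ℝ} (hr : 1 < r) (hR : 0 < R) :
    HasDerivAt (fun r => L * ((r - 1) / R) ^ κ) (L * κ / R * ((r - 1) / R) ^ (κ - 1)) r := by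
  have h1 : HasDerivAt (fun r : ℝ => (r - 1) / R) (1 / R) r :=
    ((hasDerivAt_id r).sub_const 1).div_const R
  have h2 := (h1.rpow_const (p := κ) (Or.inl (by
    have : 0 < r - 1 := by linarith
    positivity))).const_mul L
  convert! h2 using 1
  ring

/-- Growth of the comparison function `ζ = (R e / κ) y ^ κ`, with `ζ' = e y ^ (κ - 1)`. -/
lemma rpow_comparison_le {P K q κ e R y W w' C G : ℝ} (hP : 0 ≤ P) (hK : 0 ≤ K) (hq0 : 0 < q)
    (hκ0 : 1 < κ) (hκ2 : 1 ≤ (κ - 1) * q) (he0 : 0 < e) (hR1 : 1 ≤ R) (hy0 : 0 < y) (hy1 : y ≤ 1)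
    (hW0 : 0 < W) (hw'0 : 0 ≤ w') (hWq : W ^ q ≤ C * G)
    (hWw : W ^ q * w' ≤ G / (q + 1)) :
    (e * y ^ (κ - 1) * W) ^ (q - 1) *
      (P * (W * (e * ((κ - 1) / R * y ^ (κ - 1 - 1))) + W * w' * (e * y ^ (κ - 1)) ^ 2) +
        K * (e * y ^ (κ - 1) * W)) ≤
    G * (P * (C * (κ - 1) * e ^ q + e ^ (q + 1) / (q + 1)) + K * C * e ^ q) := by
  have hR0 : 0 < R := by linarith
  have hG0 : 0 ≤ C * G := le_trans (by positivity) hWq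
  -- `z₁` and `z₂` are `ζ'` and `ζ''`; `d` and `b` are the first two derivatives of `S⁻¹ ∘ ζ`, where
  -- `S' = 1/w`.
  set z₁ := e * y ^ (κ - 1) with hz₁
  set z₂ := e * ((κ - 1) / R * y ^ (κ - 1 - 1)) with hz₂
  have hz₁0 : 0 < z₁ := by positivity
  set d := z₁ * W with hd
  have hd0 : 0 < d := by positivity
  set b := W * z₂ + W * w' * z₁ ^ 2 with hb_def
  have hz₁e : z₁ ≤ e := mul_le_of_le_one_right he0.le
    (Real.rpow_le_one hy0.le hy1 (by linarith))
  have hdq : d ^ (q - 1) * d ≤ C * G * e ^ q := by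
    rw [← Real.rpow_add_one hd0.ne', sub_add_cancel, hd, Real.mul_rpow hz₁0.le hW0.le, mul_comm]
    gcongr
  have hzz : z₁ ^ (q - 1) * z₂ ≤ (κ - 1) * e ^ q := by
    have h4 : z₁ ^ (q - 1) * z₂ =
        (κ - 1) * (e ^ q * (1 / R * y ^ ((κ - 1) * q - 1))) := by
      rw [hz₁, hz₂, Real.mul_rpow he0.le (by positivity), ← Real.rpow_mul hy0.le]
      have e1 : e ^ (q - 1) * e = e ^ q := by
        rw [← Real.rpow_add_one he0.ne', sub_add_cancel]
      have e2 : y ^ ((κ - 1) * (q - 1)) * y ^ (κ - 1 - 1) = y ^ ((κ - 1) * q - 1) := by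
        rw [← Real.rpow_add hy0]; congr 1; ring
      rw [← e1, ← e2]; ring
    rw [h4]
    -- The choice `(κ - 1) q ≥ 1` leaves no negative power of `y`.
    have h5 : 1 / R * y ^ ((κ - 1) * q - 1) ≤ 1 :=
      mul_le_one₀ (by rw [div_le_one hR0]; exact hR1) (by positivity)
        (Real.rpow_le_one hy0.le hy1 (by linarith))
    have h6 : 0 < e ^ q := Real.rpow_pos_of_pos he0 _
    exact mul_le_mul_of_nonneg_left (mul_le_of_le_one_right h6.le h5) (by linarith)
  have hdb : d ^ (q - 1) * b ≤ C * G * ((κ - 1) * e ^ q) + e ^ (q + 1) * (G / (q + 1)) := by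
    have e1 : W ^ (q - 1) * W = W ^ q := by rw [← Real.rpow_add_one hW0.ne', sub_add_cancel]
    have e2 : z₁ ^ (q - 1) * z₁ ^ 2 = z₁ ^ (q + 1) := by
      rw [← Real.rpow_natCast, ← Real.rpow_add hz₁0]; congr 1; push_cast; ring
    have e3 : d ^ (q - 1) * b = W ^ q * (z₁ ^ (q - 1) * z₂) + z₁ ^ (q + 1) * (W ^ q * w') := by
      rw [hd, Real.mul_rpow hz₁0.le hW0.le, hb_def, ← e1, ← e2]; ring
    rw [e3]
    have h5 : 0 ≤ W ^ q * w' := by positivity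
    have h6 : 0 < z₁ ^ (q - 1) * z₂ := by
      have : 0 < κ - 1 := by linarith
      positivity
    gcongr
  have h5 := mul_le_mul_of_nonneg_left hdb hP
  have h6 := mul_le_mul_of_nonneg_left hdq hK
  calc _ = P * (d ^ (q - 1) * b) + K * (d ^ (q - 1) * d) := by ring
    _ ≤ _ := add_le_add h5 h6
    _ = _ := by ring

/-- By contradiction: a finite integral bounds `S`, and a slowly rising barrier `ζ` then touches `S
∘ u` where admissibility or the inequality must fail. -/
theorem kellerOsserman_of_subsolution {n k : ℕ} (hk : 1 ≤ k) (hkn : k ≤ n) {p α β : ℝ} (hp : 1 < p)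
    (hα : (k : ℝ) / n - 1 ≤ α) (hβ : β < p - 1)
    {f : ℝ → ℝ} (hf_pos : ∀ t, 0 < f t) (hf_mono : Monotone f) (hf_cont : Continuous f)
    {u : Eucl n → ℝ} (hu1 : ContDiff ℝ 1 u) (hu2 : ContDiffOn ℝ 2 u {0}ᶜ)
    (hsub : IsEntireSubsolution k p α β f u) : KellerOsserman n k p β f := by
  intro c hc
  by_contra hfin
  have hk0 : (0 : ℝ) < k := by positivity
  have hk1 : (1 : ℝ) ≤ k := by exact_mod_cast hk
  have hn : 0 < n := by omega
  have hn0 : (0 : ℝ) < n := by positivity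
  have hp1 : 0 < p - 1 := by linarith
  set q := (n : ℝ) * (p - β - 1) / k with hq
  have hq0 : 0 < q := by
    have : 0 < p - β - 1 := by linarith
    positivity
  set ν := (n : ℝ) / k with hν
  have hν0 : 0 < ν := by positivity
  set g : ℝ → ℝ := fun s => f s ^ ν with hg_def
  have hg : Continuous g := hf_cont.rpow_const fun t => Or.inl (hf_pos t).ne'
  have hgpos : ∀ t, 0 < g t := fun t => Real.rpow_pos_of_pos (hf_pos t) _
  have hgmono : Monotone g := fun s t hst => Real.rpow_le_rpow (hf_pos s).le (hf_mono hst) hν0.le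
  have hN : 0 < q + 1 := by linarith
  -- Starting below `u 0` gives `S (u 0) > 0`; at the touching point `u x ≥ u 0 > a`, as `hC`
  -- requires.
  set a := u 0 - 1 with ha
  obtain ⟨L, hL0, hL⟩ := exists_integral_lt hg hgpos
    (integrableOn_cutoffPrimitive hg hgpos hN hc hfin a)
  obtain ⟨C, hC0, hC⟩ := exists_cutoffPrimitive_rpow_le hg hgpos hgmono hN hL0 hL
  rw [add_sub_cancel_right] at hC
  set w : ℝ → ℝ := fun t => cutoffPrimitive g a t ^ (1 / (q + 1)) with hw_def
  have hw1 : ∀ t, 1 ≤ w t := fun t =>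
    Real.one_le_rpow (one_le_cutoffPrimitive hg hgpos a t) (by positivity)
  have hw0 : ∀ t, 0 < w t := fun t => zero_lt_one.trans_le (hw1 t)
  have hwinv : ∀ t, cutoffPrimitive g a t ^ (-(1 / (q + 1))) = (w t)⁻¹ := fun t =>
    Real.rpow_neg (by linarith [one_le_cutoffPrimitive hg hgpos a t]) _
  simp only [hwinv] at hL
  have hwcont : Continuous w := continuous_cutoffPrimitive_rpow hg hgpos a _
  have hwmono : Monotone w := fun s t hst => Real.rpow_le_rpow
    (by linarith [one_le_cutoffPrimitive hg hgpos a s])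
    (monotone_cutoffPrimitive hg hgpos a hst) (by positivity)
  set S : ℝ → ℝ := fun t => ∫ s in a..t, (w s)⁻¹ with hS_def
  have hwinvc : Continuous fun s => (w s)⁻¹ := hwcont.inv₀ fun t => (hw0 t).ne'
  have hS : ∀ t, HasDerivAt S (w t)⁻¹ t := fun t =>
    (hwinvc.integral_hasStrictDerivAt a t).hasDerivAt
  have hSmono : StrictMono S := strictMono_of_deriv_pos fun t => by
    rw [(hS t).deriv]; exact inv_pos.2 (hw0 t)
  have hScont : Continuous S := continuous_iff_continuousAt.2 fun t => (hS t).continuousAt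
  have hSa : S a = 0 := by simp [hS_def]
  -- The first condition excludes touching on the unit sphere; the second controls `ζ' ^ (q - 1) *
  -- ζ''` just outside it.
  obtain ⟨κ, hκ1, hκ2⟩ : ∃ κ, p / (p - 1) < κ ∧ 1 ≤ (κ - 1) * q := by
    refine ⟨p / (p - 1) + 1 + 1 / q, by have : 0 < 1 / q := by positivity
                                        linarith, ?_⟩
    have : 0 < p / (p - 1) := by positivity
    have h1 : 1 / q * q = 1 := by field_simp
    nlinarith
  have hκp : 1 < p / (p - 1) := by rw [one_lt_div hp1]; linarith
  have hκ0 : 1 < κ := hκp.trans hκ1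
  -- `e = Lκ/R` is the largest slope of `ζ`. The displayed expression is the factor from
  -- `rpow_comparison_le`; it tends to `0` with `e` because `C` and `L` do not depend on `e`. The
  -- bound `e ≤ Lκ` means `R ≥ 1`.
  obtain ⟨e, he0, heL, he⟩ : ∃ e, 0 < e ∧ e ≤ L * κ ∧ (p - 1) * (C * (κ - 1) * e ^ q +
      e ^ (q + 1) / (q + 1)) + (k - 1) * C * e ^ q < 1 / (k : ℝ) ^ (ν - 1) := by
    have hcont : ContinuousAt (fun e : ℝ => (p - 1) * (C * (κ - 1) * e ^ q +
        e ^ (q + 1) / (q + 1)) + (k - 1) * C * e ^ q) 0 := by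
      have h1 := Real.continuousAt_rpow_const 0 q (Or.inr hq0.le)
      have h2 := Real.continuousAt_rpow_const 0 (q + 1) (Or.inr hN.le)
      fun_prop
    have h0 := hcont.tendsto
    simp only [Real.zero_rpow hq0.ne', Real.zero_rpow hN.ne', mul_zero, zero_div, add_zero] at h0
    have h1 := (h0.mono_left (nhdsWithin_le_nhds (s := Set.Ioi 0))).eventually
      (gt_mem_nhds (show 0 < 1 / (k : ℝ) ^ (ν - 1) by positivity) )
    have h2 : ∀ᶠ e in 𝓝[>] (0 : ℝ), e ∈ Set.Ioo 0 (L * κ) := Ioo_mem_nhdsGT (by positivity)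
    obtain ⟨e, h3, h4⟩ := (h1.and h2).exists
    exact ⟨e, h4.1, h4.2.le, h3⟩
  set R := L * κ / e with hR
  have hR1 : 1 ≤ R := by rwa [hR, one_le_div he0]
  have hR0 : 0 < R := by linarith
  have heR : L * κ / R = e := by rw [hR]; field_simp
  set ζ : ℝ → ℝ := fun r => L * (max (r - 1) 0 / R) ^ κ with hζ_def
  have hζcont : Continuous ζ := by
    have : Continuous fun r : ℝ => max (r - 1) 0 / R := by fun_prop
    exact continuous_const.mul (this.rpow_const fun _ => Or.inr (by linarith))
  have hζ0 : ∀ r, 0 ≤ ζ r := fun r => by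
    have : 0 ≤ max (r - 1) 0 := le_max_right _ _
    positivity
  have hζle1 : ∀ r, r ≤ 1 → ζ r = 0 := fun r hr => by
    simp only [hζ_def]
    rw [max_eq_right (by linarith), zero_div, Real.zero_rpow (by linarith), mul_zero]
  have hucont : Continuous u := hu1.continuous
  have hudiff : Differentiable ℝ u := hu1.differentiable (by norm_num)
  have hu2' : ∀ x, x ≠ 0 → ContDiffAt ℝ 2 u x := fun x hx =>
    hu2.contDiffAt (isOpen_compl_singleton.mem_nhds hx)
  have hpos : ∀ x, x ≠ 0 → ∃ lam, IsEigenvalueTuple (fderiv ℝ (pField p u) x) lam ∧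
      ∃ i, 0 < lam i := fun x hx => by
    obtain ⟨-, ⟨lam, h1, h2, -⟩, -⟩ := hsub.2 x hx
    exact ⟨lam, h1, exists_pos_of_coneP hk hkn h2⟩
  -- the maximum of `S ∘ u - ζ`
  obtain ⟨x₀, hx₀, hmax₀⟩ := (isCompact_closedBall (0 : Eucl n) (1 + R)).exists_isMaxOn
    ⟨0, by simpa using (by linarith : 0 ≤ 1 + R)⟩ (f := fun x => S (u x) - ζ ‖x‖) (by fun_prop)
  have hle₀ : ∀ x : Eucl n, ‖x‖ ≤ 1 + R → S (u x) - ζ ‖x‖ ≤ S (u x₀) - ζ ‖x₀‖ := fun x hx =>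
    hmax₀ (by simpa using hx)
  have hx₀R : ‖x₀‖ ≤ 1 + R := by simpa using hx₀
  obtain ⟨x, hx1, hxR, hle⟩ : ∃ x : Eucl n, 1 ≤ ‖x‖ ∧ ‖x‖ ≤ 1 + R ∧
      ∀ y : Eucl n, ‖y‖ ≤ 1 + R → S (u y) - ζ ‖y‖ ≤ S (u x) - ζ ‖x‖ := by
    rcases le_total 1 ‖x₀‖ with h1 | h1
    · exact ⟨x₀, h1, hx₀R, hle₀⟩
    · obtain ⟨z, hz, hzmax⟩ := exists_sphere_forall_le hn hp hucont (hudiff 0) hu2' hpos one_pos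
      refine ⟨z, hz.ge, by linarith, fun y hy => (hle₀ y hy).trans ?_⟩
      rw [hζle1 _ h1, hζle1 _ hz.le]
      have := hSmono.monotone (hzmax x₀ h1)
      linarith
  have hx0 : x ≠ 0 := norm_pos_iff.1 (by linarith)
  have hSu : S (u 0) ≤ S (u x) - ζ ‖x‖ := by
    have := hle 0 (by simpa using (by linarith : 0 ≤ 1 + R))
    rwa [norm_zero, hζle1 0 zero_le_one, sub_zero] at this
  have hux : u 0 ≤ u x := by
    rw [← hSmono.le_iff_le]
    linarith [hζ0 ‖x‖]
  -- On the outer sphere `ζ = L` exceeds `S ∘ u`, while the maximum is at least `S (u 0) > 0`.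
  have hxR' : ‖x‖ < 1 + R := by
    refine lt_of_le_of_ne hxR fun h => ?_
    have h1 : ζ ‖x‖ = L := by
      simp only [hζ_def]
      rw [h, add_sub_cancel_left, max_eq_left hR0.le, div_self hR0.ne', Real.one_rpow, mul_one]
    have h2 : 0 < S (u 0) := by
      rw [← hSa]; exact hSmono (by rw [ha]; linarith)
    have h3 : S (u x) < L := hL (u x)
    linarith
  have hnear : ∀ᶠ y in 𝓝 x, S (u y) - ζ ‖y‖ ≤ S (u x) - ζ ‖x‖ :=
    (continuous_norm.continuousAt.eventually (gt_mem_nhds hxR')).mono fun y hy => hle y hy.le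
  obtain ⟨hW, ⟨lam, hlam, hcone, hineq⟩, -⟩ := hsub.2 x hx0
  rcases hx1.eq_or_lt with h1 | h1
  · -- the touching point lies on the unit sphere, where the comparison function is flat
    refine not_flat_of_pos_eigenvalue hp (Eventually.of_forall fun y => hudiff y) hW hlam
      (exists_pos_of_coneP hk hkn hcone) (C := w (u x + 1) * (L / R ^ κ)) hκ1 ?_
    filter_upwards [hnear, hucont.continuousAt.eventually
      (gt_mem_nhds (show u x < u x + 1 by linarith))] with y hy hy1
    rcases le_total (u y) (u x) with h2 | h2
    · have : 0 ≤ w (u x + 1) * (L / R ^ κ) * ‖y - x‖ ^ κ := by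
        have := (hw0 (u x + 1)).le
        positivity
      linarith
    · rw [hζle1 _ h1.ge, sub_zero] at hy
      have h3 : (u y - u x) * (w (u x + 1))⁻¹ ≤ S (u y) - S (u x) := by
        have h4 : S (u y) - S (u x) = ∫ s in (u x)..(u y), (w s)⁻¹ := by
          have := intervalIntegral.integral_add_adjacent_intervals
            (hwinvc.intervalIntegrable (μ := volume) a (u x)) (hwinvc.intervalIntegrable (u x) (u y))
          simp only [hS_def]
          linarith
        rw [h4, ← smul_eq_mul, ← intervalIntegral.integral_const]
        refine intervalIntegral.integral_mono_on h2 (by simp) (hwinvc.intervalIntegrable _ _)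
          fun s hs => ?_
        exact inv_anti₀ (hw0 s) (hwmono (by linarith [hs.2]))
      have h5 : ζ ‖y‖ ≤ L / R ^ κ * ‖y - x‖ ^ κ := by
        have h6 : max (‖y‖ - 1) 0 ≤ ‖y - x‖ := by
          refine max_le ?_ (norm_nonneg _)
          rw [h1]; exact norm_sub_norm_le y x
        simp only [hζ_def]
        rw [Real.div_rpow (le_max_right _ _) hR0.le, div_mul_eq_mul_div, mul_div_assoc]
        gcongr
      rw [← div_eq_mul_inv, div_le_iff₀ (hw0 _)] at h3
      calc u y - u x ≤ (S (u y) - S (u x)) * w (u x + 1) := h3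
        _ ≤ (L / R ^ κ * ‖y - x‖ ^ κ) * w (u x + 1) :=
          mul_le_mul_of_nonneg_right (by linarith) (hw0 _).le
        _ = _ := by ring
  · -- at a touching point outside of the unit ball, the comparison function is a supersolution
    set r := ‖x‖ with hr
    have hr0 : 0 < r := by linarith
    set y := (r - 1) / R with hy
    have hy0 : 0 < y := div_pos (by linarith) hR0
    have hy1 : y ≤ 1 := by rw [hy, div_le_one hR0]; linarith
    obtain ⟨w', hw', hw'0, hww'⟩ := hasDerivAt_cutoffPrimitive_rpow hg hgpos hN a (u x)
    rw [add_sub_cancel_right] at hww'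
    set W := w (u x) with hW_def
    have hW0 : 0 < W := hw0 _
    set z₁ := e * y ^ (κ - 1) with hz₁
    set z₂ := e * ((κ - 1) / R * y ^ (κ - 1 - 1)) with hz₂
    have hz₁0 : 0 < z₁ := by positivity
    set d := z₁ * W with hd
    have hd0 : 0 < d := by positivity
    have hζd : ∀ᶠ s in 𝓝 r, HasDerivAt ζ (e * ((s - 1) / R) ^ (κ - 1)) s := by
      filter_upwards [lt_mem_nhds h1] with s hs
      have h2 := hasDerivAt_scaled_rpow L κ R hs hR0
      rw [heR] at h2
      refine h2.congr_of_eventuallyEq ?_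
      filter_upwards [lt_mem_nhds hs] with t ht
      simp only [hζ_def]
      rw [max_eq_left (by linarith)]
    have hζd' : HasDerivAt (fun s => e * ((s - 1) / R) ^ (κ - 1)) z₂ r := by
      have h2 := hasDerivAt_scaled_rpow e (κ - 1) R h1 hR0
      convert! h2 using 1
      rw [hz₂]; ring
    obtain ⟨hgrad, hbound⟩ := eigenvalue_le_of_isLocalMax hp hx0 (hu2' x hx0)
      (Θ := S) (Θ' := fun t => (w t)⁻¹) (Θ₂ := -w' / W ^ 2) (ζ := ζ)
      (ζ' := fun s => e * ((s - 1) / R) ^ (κ - 1)) (ζ₂ := z₂) (d := d)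
      (Eventually.of_forall hS) (hw'.fun_inv hW0.ne') (inv_pos.2 hW0) hζd hζd' hnear
      (by rw [hd, hz₁, div_inv_eq_mul]) hd0.ne'
    obtain ⟨i₀, hi₀⟩ := hbound lam hlam
    have hb : (z₂ - -w' / W ^ 2 * d ^ 2) / (w (u x))⁻¹ = W * z₂ + W * w' * z₁ ^ 2 := by
      rw [div_inv_eq_mul, hd, ← hW_def]
      field_simp
      ring
    rw [abs_of_pos hd0, hb] at hi₀
    set b := W * z₂ + W * w' * z₁ ^ 2 with hb_def
    have hgn : ‖gradient u x‖ = d := by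
      rw [hgrad, norm_smul, Real.norm_of_nonneg (by positivity), div_mul_cancel₀ _ hr0.ne']
    rw [hgn] at hineq
    have hdp : 0 < d ^ (p - 2) := Real.rpow_pos_of_pos hd0 _
    have hX : 0 ≤ (p - 1) * b + (k - 1) * (d / r) := by
      have h2 := pos_of_coneP_of_le_update hk hkn hcone hi₀
      have h3 : d ^ (p - 2) * (p - 1) * b + (k - 1) * (d ^ (p - 2) * (d / r)) =
        d ^ (p - 2) * ((p - 1) * b + (k - 1) * (d / r)) := by ring
      rw [h3] at h2
      exact (pos_of_mul_pos_right h2 hdp.le).le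
    -- Monotonicity of the operator transfers the inequality from the eigenvalues of `u` to the
    -- radial tuple.
    have h2 := (le_PiK_update_iff hk hkn i₀ hr0 hd0 (hf_pos (u x)) hX).1
      (hineq.trans (Real.rpow_le_rpow (PiK_pos hcone).le (PiK_le_of_coneP hcone hi₀)
        (by positivity)))
    have hgu : f (u x) ^ ν = g (u x) := rfl
    rw [hgu] at h2
    set G := g (u x)
    have hG0 : 0 < G := hgpos _
    have hK0 : 0 < (k : ℝ) ^ (ν - 1) := Real.rpow_pos_of_pos hk0 _
    have h3 : G ≤ (k : ℝ) ^ (ν - 1) * (d ^ (q - 1) * ((p - 1) * b + (k - 1) * d)) := by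
      -- The hypothesis `α ≥ k/n - 1` says exactly that this exponent is nonnegative; here `r > 1`.
      have h4 : 1 ≤ r ^ (α * ν + ν - 1) := by
        refine Real.one_le_rpow h1.le ?_
        have h5 := mul_le_mul_of_nonneg_right hα hν0.le
        have h6 : ((k : ℝ) / n - 1) * ν = 1 - ν := by rw [hν]; field_simp
        linarith
      have h5 : d / r ≤ d := div_le_self hd0.le h1.le
      calc G ≤ r ^ (α * ν + ν - 1) * G := le_mul_of_one_le_left hG0.le h4
        _ ≤ (k : ℝ) ^ (ν - 1) * d ^ (q - 1) * ((p - 1) * b + (k - 1) * (d / r)) := h2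
        _ ≤ (k : ℝ) ^ (ν - 1) * d ^ (q - 1) * ((p - 1) * b + (k - 1) * d) := by
          gcongr
        _ = _ := by ring
    have hWq : W ^ q ≤ C * G := hC (u x) (by rw [ha]; linarith)
    have hWw : W ^ q * w' ≤ G / (q + 1) := by
      rw [show W ^ q * w' = _ from hww']
      exact div_le_div_of_nonneg_right (cutoff_mul_le hgpos a (u x)) hN.le
    have h4 := rpow_comparison_le hp1.le (by linarith : (0 : ℝ) ≤ k - 1) hq0 hκ0 hκ2 he0 hR1 hy0 hy1
      hW0 hw'0 hWq hWw
    rw [← hz₁, ← hz₂, ← hd, ← hb_def] at h4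
    have h5 : G < G := by
      calc G ≤ (k : ℝ) ^ (ν - 1) * (d ^ (q - 1) * ((p - 1) * b + (k - 1) * d)) := h3
        _ ≤ (k : ℝ) ^ (ν - 1) * (G * ((p - 1) * (C * (κ - 1) * e ^ q +
        e ^ (q + 1) / (q + 1)) + (k - 1) * C * e ^ q)) := by gcongr
        _ < (k : ℝ) ^ (ν - 1) * (G * (1 / (k : ℝ) ^ (ν - 1))) := by gcongr
        _ = G := by field_simp
    exact lt_irrefl _ h5

/-! ### Regularity and eigenvalues of radial functions ψ(K|x|^m) -/

section NormPow

variable {E : Type*} [NormedAddCommGroup E] [InnerProductSpace ℝ E]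

lemma norm_fderiv_norm_rpow_smul_le (x : E) (σ : ℝ) :
    ‖‖x‖ ^ σ • ContinuousLinearMap.id ℝ E +
      (σ * ‖x‖ ^ (σ - 2)) • InnerProductSpace.rankOne ℝ x x‖ ≤ (1 + |σ|) * ‖x‖ ^ σ := by
  have h1 : ‖(σ * ‖x‖ ^ (σ - 2)) • InnerProductSpace.rankOne ℝ x x‖ ≤ |σ| * ‖x‖ ^ σ := by
    rw [norm_smul, InnerProductSpace.norm_rankOne, norm_mul, Real.norm_eq_abs,
      Real.norm_of_nonneg (by positivity), mul_assoc]
    rcases eq_or_ne x 0 with rfl | hx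
    · simp; positivity
    · have hx' : 0 < ‖x‖ := norm_pos_iff.2 hx
      refine mul_le_mul_of_nonneg_left (le_of_eq ?_) (abs_nonneg _)
      rw [← pow_two, ← Real.rpow_natCast, ← Real.rpow_add hx']
      congr 1; push_cast; ring
  have h2 : ‖‖x‖ ^ σ • ContinuousLinearMap.id ℝ E‖ ≤ ‖x‖ ^ σ := by
    rw [norm_smul, Real.norm_of_nonneg (by positivity)]
    exact mul_le_of_le_one_right (by positivity) ContinuousLinearMap.norm_id_le
  calc _ ≤ _ := norm_add_le _ _
    _ ≤ ‖x‖ ^ σ + |σ| * ‖x‖ ^ σ := add_le_add h2 h1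
    _ = _ := by ring

lemma contDiff_norm_rpow_smul {σ : ℝ} (hσ : 0 ≤ σ) : ContDiff ℝ 1 fun x : E => ‖x‖ ^ σ • x := by
  -- For `σ = 0` the power is `1` even at the origin, so the derivative there is the identity; for
  -- `σ > 0` it is zero.
  rcases hσ.eq_or_lt with rfl | hσ
  · simp only [Real.rpow_zero, one_smul]
    exact contDiff_id
  have hlim : Tendsto (fun x : E => ‖x‖ ^ σ) (𝓝 0) (𝓝 0) := by
    have h1 : Continuous fun x : E => ‖x‖ ^ σ := continuous_norm.rpow_const fun _ => Or.inr hσ.le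
    have := h1.tendsto 0
    rwa [norm_zero, Real.zero_rpow hσ.ne'] at this
  have hd : ∀ x : E, HasFDerivAt (fun y : E => ‖y‖ ^ σ • y)
      (‖x‖ ^ σ • ContinuousLinearMap.id ℝ E +
        (σ * ‖x‖ ^ (σ - 2)) • InnerProductSpace.rankOne ℝ x x) x := by
    intro x
    rcases eq_or_ne x 0 with rfl | hx
    · rw [hasFDerivAt_iff_isLittleO, Asymptotics.isLittleO_iff]
      intro c hc
      filter_upwards [hlim.eventually (gt_mem_nhds hc)] with y hy
      simp only [norm_zero, Real.zero_rpow hσ.ne', zero_smul, map_zero, smul_zero, add_zero,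
        sub_zero, zero_apply]
      rw [norm_smul, Real.norm_of_nonneg (by positivity)]
      gcongr
    · exact hasFDerivAt_norm_rpow_smul hx σ
  rw [contDiff_one_iff_fderiv]
  refine ⟨fun x => (hd x).differentiableAt, ?_⟩
  rw [funext fun x => (hd x).fderiv, continuous_iff_continuousAt]
  intro x
  rcases eq_or_ne x 0 with rfl | hx
  · rw [ContinuousAt, norm_zero, Real.zero_rpow hσ.ne', zero_smul, map_zero, smul_zero,
      add_zero, tendsto_zero_iff_norm_tendsto_zero]
    have h1 : Tendsto (fun x : E => (1 + |σ|) * ‖x‖ ^ σ) (𝓝 0) (𝓝 0) := by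
      simpa using hlim.const_mul (1 + |σ|)
    exact squeeze_zero (fun _ => norm_nonneg _) (fun x => norm_fderiv_norm_rpow_smul_le x σ) h1
  · have hx' : ‖x‖ ≠ 0 := norm_ne_zero_iff.2 hx
    have h1 : ∀ s : ℝ, ContinuousAt (fun x : E => ‖x‖ ^ s) x := fun s =>
      continuous_norm.continuousAt.rpow_const (Or.inl hx')
    have h2 : Continuous fun x : E => InnerProductSpace.rankOne ℝ x x := by
      have : Continuous fun x : E => InnerProductSpace.rankOne ℝ (E := E) (F := E) x :=
        ContinuousLinearMap.continuous _
      exact this.clm_apply continuous_id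
    exact ((h1 σ).smul continuousAt_const).add
      ((continuousAt_const.mul (h1 (σ - 2))).smul h2.continuousAt)

lemma contDiffAt_norm_rpow {x : E} (hx : x ≠ 0) (m : ℝ) {j : WithTop ℕ∞} :
    ContDiffAt ℝ j (fun y : E => ‖y‖ ^ m) x :=
  (contDiffAt_norm ℝ hx).rpow_const_of_ne (norm_ne_zero_iff.2 hx)

end NormPow

section RadialProfile

variable {n : ℕ} {ψ : ℝ → ℝ} {K m : ℝ}

/-- This is the regular factor of the gradient; the other factor, `‖x‖ ^ (m - 2) • x`, carries any
singularity. -/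
lemma contDiff_deriv_comp_norm_rpow (hψ : ContDiff ℝ 2 ψ) (hm : 1 < m) :
    ContDiff ℝ 1 fun x : Eucl n => K * m * deriv ψ (K * ‖x‖ ^ m) := by
  have h1 : ContDiff ℝ 1 (deriv ψ) := ((contDiff_succ_iff_deriv (n := 1)).1 hψ).2.2
  exact contDiff_const.mul (h1.comp (contDiff_const.mul (contDiff_norm_rpow hm)))

lemma hasFDerivAt_comp_norm_rpow (hψ : Differentiable ℝ ψ) (hm : 1 < m) (x : Eucl n) :
    HasFDerivAt (fun x : Eucl n => ψ (K * ‖x‖ ^ m))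
      ((K * m * deriv ψ (K * ‖x‖ ^ m)) • innerSL ℝ (‖x‖ ^ (m - 2) • x)) x := by
  have h1 := (hψ (K * ‖x‖ ^ m)).hasDerivAt.comp_hasFDerivAt x
    ((hasFDerivAt_norm_rpow x hm).const_mul K)
  convert! h1 using 1
  rw [map_smul, smul_smul, smul_smul, smul_smul]
  congr 1; ring

lemma gradient_comp_norm_rpow (hψ : Differentiable ℝ ψ) (hm : 1 < m) (x : Eucl n) :
    gradient (fun x : Eucl n => ψ (K * ‖x‖ ^ m)) x =
      (K * m * deriv ψ (K * ‖x‖ ^ m)) • (‖x‖ ^ (m - 2) • x) := by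
  refine ext_inner_right ℝ fun h => ?_
  rw [inner_gradient_left, (hasFDerivAt_comp_norm_rpow hψ hm x).fderiv, inner_smul_left]
  rfl

lemma contDiff_one_comp_norm_rpow (hψ : ContDiff ℝ 2 ψ) (hm : 1 < m) :
    ContDiff ℝ 1 fun x : Eucl n => ψ (K * ‖x‖ ^ m) :=
  (hψ.of_le (by norm_num)).comp (contDiff_const.mul (contDiff_norm_rpow hm))

lemma contDiffOn_two_comp_norm_rpow (hψ : ContDiff ℝ 2 ψ) :
    ContDiffOn ℝ 2 (fun x : Eucl n => ψ (K * ‖x‖ ^ m)) {0}ᶜ := fun x hx =>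
  (hψ.contDiffAt.comp x
    (contDiffAt_const.mul (contDiffAt_norm_rpow (E := Eucl n) hx m))).contDiffWithinAt

lemma contDiff_two_comp_norm_rpow (hψ : ContDiff ℝ 2 ψ) (hm : 2 ≤ m) :
    ContDiff ℝ 2 fun x : Eucl n => ψ (K * ‖x‖ ^ m) := by
  have hψ1 : Differentiable ℝ ψ := hψ.differentiable (by norm_num)
  rw [show (2 : WithTop ℕ∞) = 1 + 1 by norm_num, contDiff_succ_iff_fderiv]
  refine ⟨fun x => (hasFDerivAt_comp_norm_rpow hψ1 (by linarith) x).differentiableAt, by simp, ?_⟩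
  rw [funext fun x => (hasFDerivAt_comp_norm_rpow (K := K) (m := m) hψ1 (by linarith) x).fderiv]
  exact (contDiff_deriv_comp_norm_rpow hψ (by linarith)).smul
    ((innerSL ℝ (E := Eucl n)).contDiff.comp (contDiff_norm_rpow_smul (by linarith)))

lemma pField_comp_norm_rpow (hψ : Differentiable ℝ ψ) (hψ' : ∀ t, 0 < deriv ψ t) (hK : 0 < K)
    (hm : 1 < m) (p : ℝ) (x : Eucl n) :
    pField p (fun x : Eucl n => ψ (K * ‖x‖ ^ m)) x =
      (K * m * deriv ψ (K * ‖x‖ ^ m)) ^ (p - 1) • (‖x‖ ^ ((m - 1) * (p - 1) - 1) • x) := by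
  rw [pField, gradient_comp_norm_rpow hψ hm]
  rcases eq_or_ne x 0 with rfl | hx
  · simp
  have hx' : 0 < ‖x‖ := norm_pos_iff.2 hx
  have hh : 0 < K * m * deriv ψ (K * ‖x‖ ^ m) := by
    have := hψ' (K * ‖x‖ ^ m)
    positivity
  set h := K * m * deriv ψ (K * ‖x‖ ^ m)
  have h1 : ‖x‖ ^ (m - 2) * ‖x‖ = ‖x‖ ^ (m - 1) := by
    rw [← Real.rpow_add_one hx'.ne']; congr 1; ring
  rw [norm_smul, norm_smul, Real.norm_of_nonneg hh.le, Real.norm_of_nonneg (by positivity), h1,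
    Real.mul_rpow hh.le (by positivity), ← Real.rpow_mul hx'.le, smul_smul, smul_smul, smul_smul]
  congr 1
  have h2 : h ^ (p - 2) * h = h ^ (p - 1) := by
    rw [← Real.rpow_add_one hh.ne']; congr 1; ring
  have h3 : ‖x‖ ^ ((m - 1) * (p - 2)) * ‖x‖ ^ (m - 2) = ‖x‖ ^ ((m - 1) * (p - 1) - 1) := by
    rw [← Real.rpow_add hx']; congr 1; ring
  rw [← h2, ← h3]; ring

/-- The field is a power of a positive `C¹` function times `‖x‖ ^ s • x` with `s = (m - 1)(p - 1) -
1`, which is `C¹` for `s ≥ 0`. -/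
lemma contDiff_pField_comp_norm_rpow (hψ : ContDiff ℝ 2 ψ) (hψ' : ∀ t, 0 < deriv ψ t) (hK : 0 < K)
    (hm : 1 < m) {p : ℝ} (hs : 0 ≤ (m - 1) * (p - 1) - 1) :
    ContDiff ℝ 1 (pField p fun x : Eucl n => ψ (K * ‖x‖ ^ m)) := by
  rw [funext (pField_comp_norm_rpow (hψ.differentiable (by norm_num)) hψ' hK hm p)]
  refine ContDiff.smul (ContDiff.rpow_const_of_ne (contDiff_deriv_comp_norm_rpow hψ hm)
    fun x => ?_) (contDiff_norm_rpow_smul hs)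
  have := hψ' (K * ‖x‖ ^ m)
  positivity

/-- Value, derivative and eigenvalues of the field `|Du|^{p-2}Du` of a radial function, in terms of
`W = |Du|`. -/
lemma eigenvalues_pField_comp_norm_rpow (hψ : Differentiable ℝ ψ) (hψ' : ∀ t, 0 < deriv ψ t)
    (hK : 0 < K) (hm : 1 < m) (p : ℝ) {x : Eucl n} (hx : x ≠ 0) {W' : ℝ}
    (hW : HasDerivAt (fun ρ => K * m * deriv ψ (K * ρ ^ m) * ρ ^ (m - 1)) W' ‖x‖) {d : ℝ}
    (hd : d = K * m * deriv ψ (K * ‖x‖ ^ m) * ‖x‖ ^ (m - 1)) (i₀ : Fin n) :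
    ‖gradient (fun x : Eucl n => ψ (K * ‖x‖ ^ m)) x‖ = d ∧
    DifferentiableAt ℝ (pField p fun x : Eucl n => ψ (K * ‖x‖ ^ m)) x ∧
    IsEigenvalueTuple (fderiv ℝ (pField p fun x : Eucl n => ψ (K * ‖x‖ ^ m)) x)
      (Function.update (fun _ => d ^ (p - 2) * (d / ‖x‖)) i₀ (d ^ (p - 2) * (p - 1) * W')) := by
  have hx' : 0 < ‖x‖ := norm_pos_iff.2 hx
  set W : ℝ → ℝ := fun ρ => K * m * deriv ψ (K * ρ ^ m) * ρ ^ (m - 1)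
  have hWpos : ∀ ρ, 0 < ρ → 0 < W ρ := fun ρ hρ => by
    have := hψ' (K * ρ ^ m)
    positivity
  have hd0 : 0 < d := by rw [hd]; exact hWpos _ hx'
  have hdW : W ‖x‖ = d := hd.symm
  have hgrad : ∀ y : Eucl n, y ≠ 0 →
      gradient (fun x : Eucl n => ψ (K * ‖x‖ ^ m)) y = (W ‖y‖ / ‖y‖) • y := fun y hy => by
    have hy' : 0 < ‖y‖ := norm_pos_iff.2 hy
    rw [gradient_comp_norm_rpow hψ hm, smul_smul]
    congr 1
    rw [eq_div_iff hy'.ne', mul_assoc, ← Real.rpow_add_one hy'.ne']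
    congr 2; ring
  have hnorm : ∀ y : Eucl n, y ≠ 0 →
      ‖gradient (fun x : Eucl n => ψ (K * ‖x‖ ^ m)) y‖ = W ‖y‖ := fun y hy => by
    have hy' : 0 < ‖y‖ := norm_pos_iff.2 hy
    have := hWpos _ hy'
    rw [hgrad y hy, norm_smul, Real.norm_of_nonneg (by positivity), div_mul_cancel₀ _ hy'.ne']
  -- Near `x` the field is a scalar function of the radius times `y`, so its derivative is a
  -- multiple of the identity plus a rank-one term.
  have hfield : (pField p fun x : Eucl n => ψ (K * ‖x‖ ^ m)) =ᶠ[𝓝 x]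
      fun y => (W ‖y‖ ^ (p - 2) * (W ‖y‖ / ‖y‖)) • y := by
    filter_upwards [isOpen_ne.mem_nhds hx] with y hy
    rw [pField, hnorm y hy, hgrad y hy, smul_smul]
  have hc : HasDerivAt (fun ρ => W ρ ^ (p - 2) * (W ρ / ρ))
      ((W' * (p - 2) * d ^ (p - 2 - 1)) * (d / ‖x‖) +
        d ^ (p - 2) * ((W' * ‖x‖ - d * 1) / ‖x‖ ^ 2)) ‖x‖ := by
    rw [← hdW]
    exact (hW.rpow_const (Or.inl (by rw [hdW]; exact hd0.ne'))).mul
      (hW.div (hasDerivAt_id _) hx'.ne')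
  have hF := (hasFDerivAt_radialField hx hc).congr_of_eventuallyEq hfield
  refine ⟨by rw [hnorm x hx, hdW], hF.differentiableAt, ?_⟩
  rw [hF.fderiv, hdW]
  convert! isEigenvalueTuple_smul_id_add_rankOne _ _ hx i₀ using 2
  have h1 : d ^ (p - 2 - 1) * d = d ^ (p - 2) := by
    rw [← Real.rpow_add_one hd0.ne', sub_add_cancel]
  rw [← h1]
  field_simp
  ring

end RadialProfile

/-! ### Sufficiency: construction of the radial subsolution -/

/-- Global solutions of autonomous scalar equations by separation of variables. -/
lemma exists_autonomous_solution {ω : ℝ → ℝ} (hω : ContDiff ℝ 1 ω) (hpos : ∀ t, 0 < ω t) (t₀ : ℝ)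
    (htop : Tendsto (fun t => ∫ s in t₀..t, (ω s)⁻¹) atTop atTop)
    (hbot : Tendsto (fun t => ∫ s in t₀..t, (ω s)⁻¹) atBot atBot) :
    ∃ ψ : ℝ → ℝ, ContDiff ℝ 2 ψ ∧ ψ 0 = t₀ ∧ ∀ s, HasDerivAt ψ (ω (ψ s)) s := by
  have hcont : Continuous fun s => (ω s)⁻¹ := hω.continuous.inv₀ fun t => (hpos t).ne'
  set Φ : ℝ → ℝ := fun t => ∫ s in t₀..t, (ω s)⁻¹ with hΦ_def
  have hΦ : ∀ t, HasDerivAt Φ (ω t)⁻¹ t := fun t =>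
    (hcont.integral_hasStrictDerivAt t₀ t).hasDerivAt
  have hmono : StrictMono Φ := strictMono_of_deriv_pos fun t => by
    rw [(hΦ t).deriv]; exact inv_pos.2 (hpos t)
  have hΦcont : Continuous Φ := continuous_iff_continuousAt.2 fun t => (hΦ t).continuousAt
  -- Divergence at both ends makes the time map `Φ` a bijection of `ℝ`; the solution is its inverse.
  let e := hmono.orderIsoOfSurjective Φ (hΦcont.surjective htop hbot)
  have he : ∀ s, Φ (e.symm s) = s := fun s => e.apply_symm_apply s
  have hd : ∀ s, HasDerivAt e.symm (ω (e.symm s)) s := fun s => by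
    have := HasDerivAt.of_local_left_inverse (f := Φ) (g := e.symm) (a := s)
      e.symm.continuous.continuousAt (hΦ (e.symm s)) (inv_pos.2 (hpos _)).ne'
      (Eventually.of_forall he)
    rwa [inv_inv] at this
  refine ⟨e.symm, ?_, ?_, hd⟩
  · have h1 : ContDiff ℝ 1 e.symm := by
      rw [contDiff_one_iff_deriv]
      refine ⟨fun s => (hd s).differentiableAt, ?_⟩
      rw [funext fun s => (hd s).deriv]
      exact hω.continuous.comp e.symm.continuous
    rw [show (2 : WithTop ℕ∞) = 1 + 1 by norm_num, contDiff_succ_iff_deriv]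
    refine ⟨fun s => (hd s).differentiableAt, by simp, ?_⟩
    rw [funext fun s => (hd s).deriv]
    exact hω.comp h1
  · refine hmono.injective ?_
    rw [he]
    simp [hΦ_def]

/-- For `σ ≤ 1`, `G` is bounded and the first term suffices; for `σ ≥ 1`, the second term is itself
a large multiple of `G`. -/
lemma le_mul_add_of_le {c A m N σ G T : ℝ} (hc : 0 < c) (hA : 0 < A) (hm : 1 < m) (hN : 0 < N)
    (hσ : 0 < σ) (hG : 0 < G) (hT : 1 ≤ T) (h1 : σ ≤ 1 → G ≤ c * (A * (m - 1)))
    (h2 : 1 ≤ c * (A * (m / N))) : G ≤ c * (A * ((m - 1) * T + m * σ * (G / N))) := by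
  have hm1 : 0 < m - 1 := by linarith
  rcases le_total σ 1 with hσ1 | hσ1
  · refine (h1 hσ1).trans ?_
    gcongr
    have h3 : 0 ≤ m * σ * (G / N) := by positivity
    have h4 : m - 1 ≤ (m - 1) * T := le_mul_of_one_le_right hm1.le hT
    linarith
  · calc G ≤ c * (A * (m / N)) * G := le_mul_of_one_le_left hG.le h2
      _ = c * (A * (m * 1 * (G / N))) := by ring
      _ ≤ c * (A * (m * σ * (G / N))) := by gcongr
      _ ≤ _ := by
        gcongr
        have : 0 ≤ (m - 1) * T := by positivity
        linarith

/-- Both radial eigenvalues are positive, so admissibility is automatic; in the inequality the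
powers of `r` cancel and a large `K` absorbs the constants. -/
theorem exists_radial_subsolution {n k : ℕ} (hk : 1 ≤ k) (hkn : k ≤ n) {p α β : ℝ} (hp : 1 < p)
    (hα : (k : ℝ) / n - 1 ≤ α) (hβ : β < p - 1)
    {f : ℝ → ℝ} (hf_pos : ∀ t, 0 < f t) (hf_mono : Monotone f) (hf_cont : Continuous f)
    (hKO : KellerOsserman n k p β f) :
    ∃ (ψ : ℝ → ℝ) (K : ℝ), ContDiff ℝ 2 ψ ∧ (∀ t, 0 < deriv ψ t) ∧ 0 < K ∧
      IsEntireSubsolution k p α β f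
        (fun x : Eucl n => ψ (K * ‖x‖ ^ (1 + (α + 1) / (p - 1 - β)))) := by
  have hk0 : (0 : ℝ) < k := by positivity
  have hk1 : (1 : ℝ) ≤ k := by exact_mod_cast hk
  have hn : 0 < n := by omega
  have hn0 : (0 : ℝ) < n := by positivity
  have hp1 : 0 < p - 1 := by linarith
  have hpβ : 0 < p - 1 - β := by linarith
  have hα1 : 0 < α + 1 := by
    have : 0 < (k : ℝ) / n := by positivity
    linarith
  set q := (n : ℝ) * (p - β - 1) / k with hq
  have hq0 : 0 < q := by
    have : 0 < p - β - 1 := by linarith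
    positivity
  have hN : 0 < q + 1 := by linarith
  set ν := (n : ℝ) / k with hν
  have hν0 : 0 < ν := by positivity
  set m := 1 + (α + 1) / (p - 1 - β) with hm
  have hm1 : 1 < m := by
    have : 0 < (α + 1) / (p - 1 - β) := by positivity
    linarith
  -- The exponent `m` is chosen for this identity, which matches the power of `r` on the two sides.
  have hmq : (m - 1) * q = α * ν + ν := by
    rw [hm, hq, hν, add_sub_cancel_left]
    have : p - β - 1 = p - 1 - β := by ring
    rw [this]
    field_simp
  set g : ℝ → ℝ := fun s => f s ^ ν with hg_def
  have hg : Continuous g := hf_cont.rpow_const fun t => Or.inl (hf_pos t).ne'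
  have hgpos : ∀ t, 0 < g t := fun t => Real.rpow_pos_of_pos (hf_pos t) _
  have hgmono : Monotone g := fun s t hst => Real.rpow_le_rpow (hf_pos s).le (hf_mono hst) hν0.le
  set ω : ℝ → ℝ := fun t => cutoffPrimitive g 0 t ^ (1 / (q + 1)) with hω_def
  have hF1 := one_le_cutoffPrimitive hg hgpos 0
  have hω1 : ∀ t, 1 ≤ ω t := fun t => Real.one_le_rpow (hF1 t) (by positivity)
  have hω0 : ∀ t, 0 < ω t := fun t => zero_lt_one.trans_le (hω1 t)
  have hωC : ContDiff ℝ 1 ω := (contDiff_cutoffPrimitive hg 0).rpow_const_of_ne fun t => by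
    linarith [hF1 t]
  have hωinv : ∀ t, cutoffPrimitive g 0 t ^ (-(1 / (q + 1))) = (ω t)⁻¹ := fun t =>
    Real.rpow_neg (by linarith [hF1 t]) _
  have htop := tendsto_integral_atTop hg hgpos (N := q + 1) fun h =>
    lintegral_ne_top_of_integrableOn_cutoffPrimitive hg hgpos hN h (hKO 1 one_pos)
  have hbot := tendsto_integral_atBot hg hgpos (N := q + 1)
  simp only [hωinv] at htop hbot
  obtain ⟨ψ, hψ, hψ0, hψd⟩ := exists_autonomous_solution hωC hω0 1 htop hbot
  have hψ1 : Differentiable ℝ ψ := hψ.differentiable (by norm_num)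
  have hψ' : ∀ t, deriv ψ t = ω (ψ t) := fun t => (hψd t).deriv
  have hψpos : ∀ t, 0 < deriv ψ t := fun t => by rw [hψ']; exact hω0 _
  have hψmono : StrictMono ψ := strictMono_of_deriv_pos hψpos
  set c := (k : ℝ) ^ (ν - 1) * (p - 1) with hc
  have hc0 : 0 < c := by positivity
  -- The two bounds serve `σ ≤ 1`, where `g (ψ σ) ≤ g (ψ 1)`, and `σ ≥ 1`.
  obtain ⟨K, hK0, hK1, hK2⟩ : ∃ K : ℝ, 0 < K ∧ g (ψ 1) ≤ c * ((K * m) ^ q * (m - 1)) ∧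
      1 ≤ c * ((K * m) ^ q * (m / (q + 1))) := by
    have hm0 : 0 < m := by linarith
    have h1 : Tendsto (fun K : ℝ => (K * m) ^ q) atTop atTop :=
      (tendsto_rpow_atTop hq0).comp (tendsto_id.atTop_mul_const hm0)
    have h2 := (h1.atTop_mul_const (by linarith : 0 < m - 1)).const_mul_atTop hc0
    have h3 := (h1.atTop_mul_const (by positivity : 0 < m / (q + 1))).const_mul_atTop hc0
    obtain ⟨K, h4, h5, h6⟩ := ((eventually_gt_atTop 0).and
      ((h2.eventually_ge_atTop (g (ψ 1))).and (h3.eventually_ge_atTop 1))).exists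
    exact ⟨K, h4, h5, h6⟩
  refine ⟨ψ, K, hψ, hψpos, hK0, ?_, fun x hx => ?_⟩
  · have : Nonempty (Fin n) := ⟨⟨0, hn⟩⟩
    obtain ⟨z, hz⟩ := (NormedSpace.sphere_nonempty (E := Eucl n) (x := 0) (r := 1)).2 zero_le_one
    have hzn : ‖z‖ = 1 := by simpa using hz
    refine ⟨0, z, (hψmono ?_).ne⟩
    rw [norm_zero, Real.zero_rpow (by linarith), hzn, Real.one_rpow, mul_zero, mul_one]
    exact hK0
  · have hr0 : 0 < ‖x‖ := norm_pos_iff.2 hx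
    set r := ‖x‖ with hr
    set σ := K * r ^ m with hσ
    have hσ0 : 0 < σ := by positivity
    obtain ⟨ω', hω', hω'0, hωω'⟩ := hasDerivAt_cutoffPrimitive_rpow hg hgpos hN 0 (ψ σ)
    rw [add_sub_cancel_right] at hωω'
    -- The solution starts at `1 = a + 1` with `a = 0`, so along it the cutoff factor is `1` and `θ
    -- ^ q * ω'` is the full `g / (q + 1)`.
    have hψσ : 1 ≤ ψ σ := by rw [← hψ0]; exact hψmono.monotone hσ0.le
    rw [sub_zero, min_eq_left hψσ, max_eq_right zero_le_one, one_mul] at hωω'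
    set θ := ω (ψ σ) with hθ
    have hθ1 : 1 ≤ θ := hω1 _
    have hθ0 : 0 < θ := hω0 _
    set d := K * m * deriv ψ (K * ‖x‖ ^ m) * ‖x‖ ^ (m - 1) with hd
    have hdθ : d = K * m * θ * r ^ (m - 1) := by rw [hd, hψ']
    have hd0 : 0 < d := by rw [hdθ]; positivity
    set W' := K * m * (ω' * (θ * (K * (m * r ^ (m - 1))))) * r ^ (m - 1) +
      K * m * θ * ((m - 1) * r ^ (m - 1 - 1)) with hW'
    have hWd : HasDerivAt (fun ρ => K * m * deriv ψ (K * ρ ^ m) * ρ ^ (m - 1)) W' r := by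
      simp only [hψ']
      have h1 : HasDerivAt (fun ρ : ℝ => K * ρ ^ m) (K * (m * r ^ (m - 1))) r :=
        (Real.hasDerivAt_rpow_const (Or.inl hr0.ne')).const_mul K
      have h2 : HasDerivAt (fun ρ : ℝ => ψ (K * ρ ^ m)) (θ * (K * (m * r ^ (m - 1)))) r :=
        (hψd σ).comp r h1
      have h3 : HasDerivAt (fun ρ : ℝ => ω (ψ (K * ρ ^ m)))
          (ω' * (θ * (K * (m * r ^ (m - 1))))) r :=
        HasDerivAt.comp (h₂ := ω) (h := fun ρ => ψ (K * ρ ^ m)) r hω' h2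
      exact (h3.const_mul (K * m)).mul (Real.hasDerivAt_rpow_const (Or.inl hr0.ne'))
    obtain ⟨hgn, hdiff, heig⟩ := eigenvalues_pField_comp_norm_rpow hψ1 hψpos hK0 hm1 p hx hWd hd
      ⟨0, hn⟩
    have hW'0 : 0 < W' := by
      have : 0 < m - 1 := by linarith
      positivity
    have hdp : 0 < d ^ (p - 2) := Real.rpow_pos_of_pos hd0 _
    refine ⟨hdiff, ⟨_, heig, update_mem_coneP hk (by positivity) (by positivity) _, ?_⟩, ?_⟩
    · have hX : 0 ≤ (k - 1) * (d / r) := mul_nonneg (by linarith) (by positivity)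
      rw [hgn, le_PiK_update_iff hk hkn _ hr0 hd0 (hf_pos _) (by positivity)]
      change r ^ (α * ν + ν - 1) * g (ψ σ) ≤ _
      have hA : d ^ (q - 1) * W' = (K * m) ^ q * r ^ (α * ν + ν - 1) *
          ((m - 1) * θ ^ q + m * σ * (g (ψ σ) / (q + 1))) := by
        have e1 : θ ^ (q - 1) * θ = θ ^ q := by rw [← Real.rpow_add_one hθ0.ne', sub_add_cancel]
        have e2 : (K * m) ^ (q - 1) * (K * m) = (K * m) ^ q := by
          rw [← Real.rpow_add_one (by positivity), sub_add_cancel]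
        have e3 : r ^ ((m - 1) * (q - 1)) * r ^ (m - 1 - 1) = r ^ (α * ν + ν - 1) := by
          rw [← Real.rpow_add hr0, ← hmq]; congr 1; ring
        have e4 : r ^ (m - 1) * r ^ (m - 1) = r ^ m * r ^ (m - 1 - 1) := by
          rw [← Real.rpow_add hr0, ← Real.rpow_add hr0]; congr 1; ring
        have e5 : θ ^ q * ω' = g (ψ σ) / (q + 1) := hωω'
        have e6 : d ^ (q - 1) = (K * m) ^ (q - 1) * θ ^ (q - 1) * r ^ ((m - 1) * (q - 1)) := by
          rw [hdθ, Real.mul_rpow (by positivity) (by positivity),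
            Real.mul_rpow (by positivity) hθ0.le, ← Real.rpow_mul hr0.le]
        have e7 : W' = (K * m) * θ * r ^ (m - 1 - 1) * ((m - 1) + m * σ * ω') := by
          rw [hW', hσ]
          linear_combination (K * m * ω' * θ * K * m) * e4
        rw [e6, e7, ← e5, ← e1, ← e2, ← e3]
        ring
      have hmain : g (ψ σ) ≤
          c * ((K * m) ^ q * ((m - 1) * θ ^ q + m * σ * (g (ψ σ) / (q + 1)))) := by
        refine le_mul_add_of_le hc0 (Real.rpow_pos_of_pos (by positivity) _) hm1 hN hσ0 (hgpos _)
          (Real.one_le_rpow hθ1 hq0.le) (fun hσ1 => ?_) hK2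
        exact (hgmono (hψmono.monotone hσ1)).trans hK1
      calc r ^ (α * ν + ν - 1) * g (ψ σ)
          ≤ r ^ (α * ν + ν - 1) *
            (c * ((K * m) ^ q * ((m - 1) * θ ^ q + m * σ * (g (ψ σ) / (q + 1))))) := by gcongr
        _ = (k : ℝ) ^ (ν - 1) * d ^ (q - 1) * ((p - 1) * W') := by
          rw [hc]; linear_combination -(k : ℝ) ^ (ν - 1) * (p - 1) * hA
        _ ≤ (k : ℝ) ^ (ν - 1) * d ^ (q - 1) * ((p - 1) * W' + (k - 1) * (d / r)) := by
          gcongr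
          linarith
    · intro _
      rw [← norm_pos_iff, hgn]
      exact hd0

/-! ### Local integrability and weak second derivatives -/

lemma memLpLoc_norm_rpow {n : ℕ} (hn : 0 < n) {σ δ : ℝ} (hδ : 0 < δ) (hσ : -1 < σ * δ) :
    MemLpLoc δ fun x : Eucl n => ‖x‖ ^ σ := by
  intro K hK
  have : Nonempty (Fin n) := ⟨⟨0, hn⟩⟩
  have hmeas : Measurable fun x : Eucl n => ‖x‖ ^ σ := measurable_norm.pow_const σ
  rw [← integrable_norm_rpow_iff hmeas.aestronglyMeasurable (by simpa using hδ) (by simp),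
    ENNReal.toReal_ofReal hδ.le]
  obtain ⟨R, hR⟩ := hK.isBounded.subset_ball 0
  have h1 : IntegrableOn (fun x : Eucl n => (fun r : ℝ => ‖r ^ σ‖ ^ δ) ‖x‖)
      (Metric.ball 0 (max R 1)) := by
    -- In polar coordinates the weight `r ^ (n - 1)` is merely bounded, which costs the sharp
    -- threshold `-n` but gives a condition valid in every dimension.
    refine (integrableOn_fun_norm_addHaar volume (f := fun r : ℝ => ‖r ^ σ‖ ^ δ)).2 ?_
    have h2 : IntegrableOn (fun y : ℝ => y ^ (σ * δ)) (Set.Ioo 0 (max R 1)) :=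
      (intervalIntegral.integrableOn_Ioo_rpow_iff (by positivity)).2 hσ
    refine Integrable.mono' (h2.const_mul (max R 1 ^ (n - 1)))
      (Measurable.aestronglyMeasurable (by fun_prop)) ?_
    refine (ae_restrict_iff' measurableSet_Ioo).2 (Eventually.of_forall fun y hy => ?_)
    have hy0 : 0 < y := hy.1
    rw [finrank_euclideanSpace_fin, smul_eq_mul, norm_mul, norm_pow, Real.norm_of_nonneg hy0.le,
      Real.norm_of_nonneg (by positivity), Real.norm_of_nonneg (by positivity),
      ← Real.rpow_mul hy0.le]
    have := hy.2.le
    gcongr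
  exact h1.mono_set (hR.trans (Metric.ball_subset_ball (le_max_left _ _)))

lemma MemLpLoc.of_le_continuous_mul {n : ℕ} {δ : ℝ} {f v B : Eucl n → ℝ} (hv : MemLpLoc δ v)
    (hf : AEStronglyMeasurable f volume) (hB : Continuous B) (h : ∀ᵐ x, ‖f x‖ ≤ B x * ‖v x‖) :
    MemLpLoc δ f := by
  intro K hK
  obtain ⟨C, hC⟩ := hK.exists_bound_of_continuousOn hB.continuousOn
  refine (hv K hK).of_le_mul hf.restrict (c := C) ?_
  filter_upwards [ae_restrict_of_ae h, ae_restrict_mem hK.measurableSet] with x hx hxK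
  refine hx.trans (mul_le_mul_of_nonneg_right ?_ (norm_nonneg _))
  exact (le_abs_self _).trans (hC x hxK)

lemma memLpLoc_of_continuous {n : ℕ} (δ : ℝ) {f : Eucl n → ℝ} (hf : Continuous f) :
    MemLpLoc δ f := by
  intro K hK
  obtain ⟨C, hC⟩ := hK.exists_bound_of_continuousOn hf.continuousOn
  have : IsFiniteMeasure (volume.restrict K) := ⟨by simpa using hK.measure_lt_top⟩
  refine MemLp.of_bound hf.aestronglyMeasurable C ?_
  filter_upwards [ae_restrict_mem hK.measurableSet] with x hx
  exact hC x hx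

lemma MemLpLoc.locallyIntegrable {n : ℕ} {δ : ℝ} (hδ : 1 ≤ δ) {f : Eucl n → ℝ}
    (hf : MemLpLoc δ f) : LocallyIntegrable f volume := by
  rw [locallyIntegrable_iff]
  intro K hK
  have : IsFiniteMeasure (volume.restrict K) := ⟨by simpa using hK.measure_lt_top⟩
  exact (hf K hK).integrable (by simpa using hδ)

lemma integral_mul_fderiv_of_contDiff {n : ℕ} {v φ : Eucl n → ℝ} (hv : ContDiff ℝ 1 v)
    (hφ : ContDiff ℝ ((⊤ : ℕ∞) : WithTop ℕ∞) φ) (hφc : HasCompactSupport φ) (e : Eucl n) :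
    ∫ x, v x * fderiv ℝ φ x e = - ∫ x, fderiv ℝ v x e * φ x := by
  have h1 : Continuous fun x => fderiv ℝ v x e :=
    (hv.continuous_fderiv (by norm_num)).clm_apply continuous_const
  have h2 : Continuous fun x => fderiv ℝ φ x e :=
    (hφ.continuous_fderiv (by simp)).clm_apply continuous_const
  have h3 : HasCompactSupport fun x => fderiv ℝ φ x e := hφc.fderiv_apply ℝ e
  exact integral_mul_fderiv_eq_neg_fderiv_mul_of_integrable
    ((h1.mul hφ.continuous).integrable_of_hasCompactSupport hφc.mul_left)
    ((hv.continuous.mul h2).integrable_of_hasCompactSupport h3.mul_left)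
    ((hv.continuous.mul hφ.continuous).integrable_of_hasCompactSupport hφc.mul_left)
    (fun x _ => hv.differentiable (by norm_num) x) (fun x _ => hφ.differentiable (by simp) x)

section SingularField

variable {n : ℕ} {h : Eucl n → ℝ} {σ : ℝ}

/-- A `C¹` regularization, for `ε > 0`, of the singular function `h |x|^σ xᵢ`. -/
noncomputable def regularizedField (h : Eucl n → ℝ) (σ : ℝ) (i : Fin n) (ε : ℝ) (x : Eucl n) : ℝ :=
  h x * x i * (‖x‖ ^ 2 + ε) ^ (σ / 2)

/-- The partial derivative of the regularized field. -/
noncomputable def regularizedFieldDeriv (h : Eucl n → ℝ) (σ : ℝ) (i j : Fin n) (ε : ℝ)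
    (x : Eucl n) : ℝ :=
  (fderiv ℝ h x (EuclideanSpace.single j 1) * x i + h x * EuclideanSpace.single j (1 : ℝ) i) *
      (‖x‖ ^ 2 + ε) ^ (σ / 2) +
    h x * x i * (σ * (‖x‖ ^ 2 + ε) ^ (σ / 2 - 1) * x j)

lemma regularizedField_zero (i : Fin n) (x : Eucl n) :
    regularizedField h σ i 0 x = h x * (‖x‖ ^ σ * x i) := by
  rw [regularizedField, add_zero, ← Real.rpow_natCast, ← Real.rpow_mul (norm_nonneg _)]
  have : ((2 : ℕ) : ℝ) * (σ / 2) = σ := by push_cast; ring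
  rw [this]; ring

lemma hasFDerivAt_coord (i : Fin n) (x : Eucl n) :
    HasFDerivAt (fun y : Eucl n => y i) (EuclideanSpace.proj i : Eucl n →L[ℝ] ℝ) x :=
  (EuclideanSpace.proj i : Eucl n →L[ℝ] ℝ).hasFDerivAt

lemma contDiff_regularizedField (hh : ContDiff ℝ 1 h) (i : Fin n) {ε : ℝ} (hε : 0 < ε) :
    ContDiff ℝ 1 (regularizedField h σ i ε) := by
  have h1 : ContDiff ℝ 1 fun x : Eucl n => x i :=
    (EuclideanSpace.proj i : Eucl n →L[ℝ] ℝ).contDiff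
  have h2 : ContDiff ℝ 1 fun x : Eucl n => ‖x‖ ^ 2 + ε :=
    (contDiff_norm_sq ℝ).add contDiff_const
  exact (hh.mul h1).mul (h2.rpow_const_of_ne fun x => by positivity)

lemma fderiv_regularizedField (hh : ContDiff ℝ 1 h) (i j : Fin n) {ε : ℝ} (hε : 0 < ε)
    (x : Eucl n) : fderiv ℝ (regularizedField h σ i ε) x (EuclideanSpace.single j 1) =
      regularizedFieldDeriv h σ i j ε x := by
  have h1 := (hh.differentiable (by norm_num) x).hasFDerivAt.mul (hasFDerivAt_coord i x)
  have h2 := ((hasStrictFDerivAt_norm_sq x).hasFDerivAt.add_const ε).rpow_const (p := σ / 2)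
    (Or.inl (by positivity))
  have h3 : HasFDerivAt (regularizedField h σ i ε) _ x := h1.mul h2
  rw [h3.fderiv, regularizedFieldDeriv]
  simp [EuclideanSpace.inner_single_right]
  split_ifs <;> ring

lemma abs_coord_le (x : Eucl n) (i : Fin n) : |x i| ≤ ‖x‖ := by
  simpa using PiLp.norm_apply_le x i

/-- As `σ ≤ 0`, adding `ε` lowers the power; this provides majorants independent of `ε`. -/
lemma rpow_norm_sq_add_le (hσ : σ ≤ 0) {ε : ℝ} (hε : 0 ≤ ε) {x : Eucl n} (hx : x ≠ 0) :
    (‖x‖ ^ 2 + ε) ^ (σ / 2) ≤ ‖x‖ ^ σ := by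
  have hx' : 0 < ‖x‖ := norm_pos_iff.2 hx
  have h1 : (‖x‖ ^ 2) ^ (σ / 2) = ‖x‖ ^ σ := by
    rw [← Real.rpow_natCast, ← Real.rpow_mul hx'.le]
    congr 1; push_cast; ring
  rw [← h1]
  exact Real.rpow_le_rpow_of_nonpos (by positivity) (by linarith) (by linarith)

lemma norm_regularizedField_le (hσ : σ ≤ 0) (i : Fin n) {ε : ℝ} (hε : 0 ≤ ε) {x : Eucl n}
    (hx : x ≠ 0) : ‖regularizedField h σ i ε x‖ ≤ (|h x| * ‖x‖) * ‖‖x‖ ^ σ‖ := by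
  have h1 : 0 ≤ (‖x‖ ^ 2 + ε) ^ (σ / 2) := by positivity
  rw [regularizedField, norm_mul, norm_mul, Real.norm_of_nonneg h1,
    Real.norm_of_nonneg (Real.rpow_nonneg (norm_nonneg x) σ), Real.norm_eq_abs, Real.norm_eq_abs]
  have := rpow_norm_sq_add_le hσ hε hx
  have := abs_coord_le x i
  gcongr

lemma norm_regularizedFieldDeriv_le (hσ : σ ≤ 0) (i j : Fin n) {ε : ℝ} (hε : 0 ≤ ε) {x : Eucl n}
    (hx : x ≠ 0) : ‖regularizedFieldDeriv h σ i j ε x‖ ≤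
      (‖fderiv ℝ h x‖ * ‖x‖ + |h x| * (1 + |σ|)) * ‖‖x‖ ^ σ‖ := by
  have hx' : 0 < ‖x‖ := norm_pos_iff.2 hx
  have hpos : 0 < ‖x‖ ^ 2 + ε := by positivity
  set ρ := (‖x‖ ^ 2 + ε) ^ (σ / 2) with hρ
  have hρ0 : 0 ≤ ρ := by positivity
  have hρle : ρ ≤ ‖x‖ ^ σ := rpow_norm_sq_add_le hσ hε hx
  have hi := abs_coord_le x i
  have hj := abs_coord_le x j
  have h1 : |fderiv ℝ h x (EuclideanSpace.single j 1) * x i| ≤ ‖fderiv ℝ h x‖ * ‖x‖ := by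
    rw [abs_mul]
    have := (fderiv ℝ h x).le_opNorm (EuclideanSpace.single j 1)
    rw [PiLp.norm_single, norm_one, mul_one, Real.norm_eq_abs] at this
    gcongr
  have h2 : |h x * EuclideanSpace.single j (1 : ℝ) i| ≤ |h x| := by
    rw [abs_mul]
    refine mul_le_of_le_one_right (abs_nonneg _) ?_
    simpa using abs_coord_le (EuclideanSpace.single j (1 : ℝ)) i
  have h3 : |h x * x i * (σ * (‖x‖ ^ 2 + ε) ^ (σ / 2 - 1) * x j)| ≤ |h x| * |σ| * ρ := by
    -- The additional power `-1` is absorbed by `|x i| |x j| ≤ ‖x‖ ^ 2 + ε`.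
    have h4 : (‖x‖ ^ 2 + ε) ^ (σ / 2 - 1) * (|x i| * |x j|) ≤ ρ := by
      rw [Real.rpow_sub_one hpos.ne', ← hρ, div_mul_eq_mul_div, div_le_iff₀ hpos]
      have : |x i| * |x j| ≤ ‖x‖ * ‖x‖ := by gcongr
      refine mul_le_mul_of_nonneg_left ?_ hρ0
      nlinarith
    rw [abs_mul, abs_mul, abs_mul, abs_mul, abs_of_nonneg (Real.rpow_nonneg hpos.le (σ / 2 - 1))]
    calc _ = |h x| * |σ| * ((‖x‖ ^ 2 + ε) ^ (σ / 2 - 1) * (|x i| * |x j|)) := by ring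
      _ ≤ _ := by gcongr
  rw [regularizedFieldDeriv, Real.norm_eq_abs, Real.norm_of_nonneg (by positivity)]
  calc _ ≤ _ := abs_add_le _ _
    _ ≤ (‖fderiv ℝ h x‖ * ‖x‖ + |h x|) * ρ + |h x| * |σ| * ρ := by
      refine add_le_add ?_ h3
      rw [abs_mul, abs_of_nonneg hρ0]
      exact mul_le_mul_of_nonneg_right ((abs_add_le _ _).trans (add_le_add h1 h2)) hρ0
    _ = (‖fderiv ℝ h x‖ * ‖x‖ + |h x| * (1 + |σ|)) * ρ := by ring
    _ ≤ _ := by gcongr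

lemma continuousAt_rpow_norm_sq_add {x : Eucl n} (hx : x ≠ 0) (s : ℝ) :
    Tendsto (fun ε : ℝ => (‖x‖ ^ 2 + ε) ^ s) (𝓝[>] 0) (𝓝 ((‖x‖ ^ 2 + 0) ^ s)) := by
  have hx' : 0 < ‖x‖ := norm_pos_iff.2 hx
  have h1 : ContinuousAt (fun ε : ℝ => ‖x‖ ^ 2 + ε) 0 := by fun_prop
  exact (h1.rpow_const (Or.inl (by positivity))).tendsto.mono_left nhdsWithin_le_nhds

lemma measurable_regularizedField (hh : ContDiff ℝ 1 h) (i : Fin n) (ε : ℝ) :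
    Measurable (regularizedField h σ i ε) := by
  have h1 : Measurable fun x : Eucl n => x i :=
    (EuclideanSpace.proj i : Eucl n →L[ℝ] ℝ).continuous.measurable
  exact (hh.continuous.measurable.mul h1).mul
    (((measurable_norm.pow_const 2).add_const ε).pow_const _)

lemma measurable_regularizedFieldDeriv (hh : ContDiff ℝ 1 h) (i j : Fin n) (ε : ℝ) :
    Measurable (regularizedFieldDeriv h σ i j ε) := by
  have h1 : ∀ i, Measurable fun x : Eucl n => x i := fun i =>
    (EuclideanSpace.proj i : Eucl n →L[ℝ] ℝ).continuous.measurable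
  have h2 : Measurable fun x => fderiv ℝ h x (EuclideanSpace.single j 1) :=
    ((hh.continuous_fderiv (by norm_num)).clm_apply continuous_const).measurable
  have h3 : ∀ s : ℝ, Measurable fun x : Eucl n => (‖x‖ ^ 2 + ε) ^ s := fun s =>
    ((measurable_norm.pow_const 2).add_const ε).pow_const s
  have h4 := hh.continuous.measurable
  unfold regularizedFieldDeriv
  exact (((h2.mul (h1 i)).add (h4.mul_const (EuclideanSpace.single j (1 : ℝ) i))).mul
    (h3 (σ / 2))).add ((h4.mul (h1 i)).mul (((h3 (σ / 2 - 1)).const_mul σ).mul (h1 j)))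

lemma ae_ne_zero (hn : 0 < n) : ∀ᵐ x : Eucl n, x ≠ 0 := by
  have : Nonempty (Fin n) := ⟨⟨0, hn⟩⟩
  rw [ae_iff]
  simp

/-- Integrate by parts for `ε > 0` and let `ε → 0` by dominated convergence: field and derivative
are bounded by continuous multiples of `‖x‖ ^ σ`, locally integrable since `σ > -1`. No boundary
term at the origin has to be estimated. -/
lemma isWeakPartial_regularizedField_zero (hn : 0 < n) (hh : ContDiff ℝ 1 h) (hσ0 : σ ≤ 0)
    (hσ : -1 < σ) (i j : Fin n) :
    IsWeakPartial j (regularizedField h σ i 0) (regularizedFieldDeriv h σ i j 0) := by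
  have hloc : MemLpLoc 1 fun x : Eucl n => ‖x‖ ^ σ :=
    memLpLoc_norm_rpow hn one_pos (by linarith)
  have hB : Continuous fun x => |h x| * ‖x‖ := hh.continuous.abs.mul continuous_norm
  have hB' : Continuous fun x => ‖fderiv ℝ h x‖ * ‖x‖ + |h x| * (1 + |σ|) :=
    ((hh.continuous_fderiv (by norm_num)).norm.mul continuous_norm).add
      (hh.continuous.abs.mul continuous_const)
  have hne := ae_ne_zero hn
  refine ⟨(hloc.of_le_continuous_mul (measurable_regularizedField hh i 0).aestronglyMeasurable hB
      (hne.mono fun x hx => norm_regularizedField_le hσ0 i le_rfl hx)).locallyIntegrable le_rfl,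
    (hloc.of_le_continuous_mul (measurable_regularizedFieldDeriv hh i j 0).aestronglyMeasurable hB'
      (hne.mono fun x hx => norm_regularizedFieldDeriv_le hσ0 i j le_rfl hx)).locallyIntegrable
      le_rfl, fun φ hφ hφc => ?_⟩
  set e : Eucl n := EuclideanSpace.single j 1
  have hli := hloc.locallyIntegrable le_rfl
  have hφ' : Continuous fun x => fderiv ℝ φ x e :=
    (hφ.continuous_fderiv (by simp)).clm_apply continuous_const
  have hφ'c : HasCompactSupport fun x => fderiv ℝ φ x e := hφc.fderiv_apply ℝ e
  have hpos : ∀ᶠ ε : ℝ in 𝓝[>] 0, 0 < ε := self_mem_nhdsWithin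
  have h1 : Tendsto (fun ε : ℝ => ∫ x, regularizedField h σ i ε x * fderiv ℝ φ x e) (𝓝[>] 0)
      (𝓝 (∫ x, regularizedField h σ i 0 x * fderiv ℝ φ x e)) := by
    refine tendsto_integral_filter_of_dominated_convergence
      (fun x => ((|h x| * ‖x‖) * ‖fderiv ℝ φ x e‖) * ‖x‖ ^ σ)
      (Eventually.of_forall fun ε =>
        ((measurable_regularizedField hh i ε).mul hφ'.measurable).aestronglyMeasurable)
      ?_ ?_ ?_
    · filter_upwards [hpos] with ε hε
      filter_upwards [hne] with x hx
      have := norm_regularizedField_le (h := h) hσ0 i hε.le hx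
      rw [Real.norm_of_nonneg (Real.rpow_nonneg (norm_nonneg x) σ)] at this
      rw [norm_mul]
      calc _ ≤ (|h x| * ‖x‖ * ‖x‖ ^ σ) * ‖fderiv ℝ φ x e‖ := by gcongr
        _ = _ := by ring
    · exact hli.integrable_smul_left_of_hasCompactSupport (hB.mul hφ'.norm) hφ'c.norm.mul_left
    · filter_upwards [hne] with x hx
      exact ((continuousAt_rpow_norm_sq_add hx _).const_mul _).mul_const _
  have h2 : Tendsto (fun ε : ℝ => ∫ x, regularizedFieldDeriv h σ i j ε x * φ x) (𝓝[>] 0)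
      (𝓝 (∫ x, regularizedFieldDeriv h σ i j 0 x * φ x)) := by
    refine tendsto_integral_filter_of_dominated_convergence
      (fun x => ((‖fderiv ℝ h x‖ * ‖x‖ + |h x| * (1 + |σ|)) * ‖φ x‖) * ‖x‖ ^ σ)
      (Eventually.of_forall fun ε =>
        ((measurable_regularizedFieldDeriv hh i j ε).mul
          hφ.continuous.measurable).aestronglyMeasurable)
      ?_ ?_ ?_
    · filter_upwards [hpos] with ε hε
      filter_upwards [hne] with x hx
      have := norm_regularizedFieldDeriv_le (h := h) hσ0 i j hε.le hx
      rw [Real.norm_of_nonneg (Real.rpow_nonneg (norm_nonneg x) σ)] at this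
      rw [norm_mul]
      calc _ ≤ ((‖fderiv ℝ h x‖ * ‖x‖ + |h x| * (1 + |σ|)) * ‖x‖ ^ σ) * ‖φ x‖ := by gcongr
        _ = _ := by ring
    · exact hli.integrable_smul_left_of_hasCompactSupport (hB'.mul hφ.continuous.norm)
        hφc.norm.mul_left
    · filter_upwards [hne] with x hx
      exact (((continuousAt_rpow_norm_sq_add hx _).const_mul _).add
        ((((continuousAt_rpow_norm_sq_add hx _).const_mul σ).mul_const _).const_mul _)).mul_const _
  refine tendsto_nhds_unique h1 (h2.neg.congr' ?_)
  filter_upwards [hpos] with ε hε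
  rw [integral_mul_fderiv_of_contDiff (contDiff_regularizedField hh i hε) hφ hφc]
  simp only [e, fderiv_regularizedField hh i j hε]

end SingularField

/-- The first derivatives are continuous; the second ones are bounded by a continuous multiple of
`‖x‖ ^ (m - 2)`, and `(2 - m) δ < 1` puts this in `L^δ_loc`. -/
lemma memW2Loc_comp_norm_rpow {n : ℕ} (hn : 0 < n) {ψ : ℝ → ℝ} {K m δ : ℝ} (hψ : ContDiff ℝ 2 ψ)
    (hm : 1 < m) (hm2 : m ≤ 2) (hδ : 1 ≤ δ) (hmδ : (2 - m) * δ < 1) :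
    MemW2Loc δ fun x : Eucl n => ψ (K * ‖x‖ ^ m) := by
  have hψ1 : Differentiable ℝ ψ := hψ.differentiable (by norm_num)
  set u : Eucl n → ℝ := fun x => ψ (K * ‖x‖ ^ m) with hu_def
  have hu : ContDiff ℝ 1 u := contDiff_one_comp_norm_rpow hψ hm
  set h : Eucl n → ℝ := fun x => K * m * deriv ψ (K * ‖x‖ ^ m) with hh_def
  have hh : ContDiff ℝ 1 h := contDiff_deriv_comp_norm_rpow hψ hm
  have hloc : MemLpLoc δ fun x : Eucl n => ‖x‖ ^ (m - 2) :=
    memLpLoc_norm_rpow hn (by linarith) (by linarith)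
  have hgu : ∀ i x, fderiv ℝ u x (EuclideanSpace.single i 1) = regularizedField h (m - 2) i 0 x := by
    intro i x
    rw [← inner_gradient_left, gradient_comp_norm_rpow hψ1 hm, regularizedField_zero]
    simp [EuclideanSpace.inner_single_right, hh_def]
  have hcont : ∀ i, Continuous (regularizedField h (m - 2) i 0) := fun i => by
    rw [← funext (hgu i)]
    exact (hu.continuous_fderiv (by norm_num)).clm_apply continuous_const
  refine ⟨memLpLoc_of_continuous δ hu.continuous, fun i => regularizedField h (m - 2) i 0,
    fun i j => regularizedFieldDeriv h (m - 2) i j 0, fun i => ⟨memLpLoc_of_continuous δ (hcont i),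
      hu.continuous.locallyIntegrable, (hcont i).locallyIntegrable, fun φ hφ hφc => ?_⟩,
    fun i j => ⟨?_, isWeakPartial_regularizedField_zero hn hh (by linarith) (by linarith) i j⟩⟩
  · rw [integral_mul_fderiv_of_contDiff hu hφ hφc]
    simp only [hgu]
  · refine hloc.of_le_continuous_mul
      (measurable_regularizedFieldDeriv hh i j 0).aestronglyMeasurable
      (((hh.continuous_fderiv (by norm_num)).norm.mul continuous_norm).add
        (hh.continuous.abs.mul continuous_const)) ((ae_ne_zero hn).mono fun x hx =>
          norm_regularizedFieldDeriv_le (by linarith) i j le_rfl hx)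

end PiHessian

/-! ### The theorem: both regularity regimes -/

theorem theorem5p1 (n k : ℕ) (hk : 1 ≤ k) (hkn : k ≤ n) (p α β : ℝ) (hp : 1 < p)
    (hα : (k : ℝ) / n - 1 ≤ α) (hβ : β < p - 1)
    (f : ℝ → ℝ) (hf_pos : ∀ t, 0 < f t) (hf_mono : Monotone f) (hf_cont : Continuous f) :
    (p ≤ α + β + 2 →
      ((∃ u : PiHessian.Eucl n → ℝ, ContDiff ℝ 2 u ∧
          PiHessian.IsEntireSubsolution k p α β f u) ↔
        PiHessian.KellerOsserman n k p β f)) ∧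
    (α + β + 2 < p → 0 ≤ (p - 1) * α + β →
      ∀ δ : ℝ, 1 < δ → δ < (p - β - 1) / (p - α - β - 2) →
        ((∃ u : PiHessian.Eucl n → ℝ, ContDiff ℝ 1 u ∧ ContDiffOn ℝ 2 u {0}ᶜ ∧
            PiHessian.MemW2Loc δ u ∧ PiHessian.IsEntireSubsolution k p α β f u) ↔
          PiHessian.KellerOsserman n k p β f) ∧
        (PiHessian.KellerOsserman n k p β f →
          ∃ u : PiHessian.Eucl n → ℝ, ContDiff ℝ 1 u ∧ ContDiffOn ℝ 2 u {0}ᶜ ∧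
            PiHessian.MemW2Loc δ u ∧ PiHessian.IsEntireSubsolution k p α β f u ∧
            ContDiff ℝ 1 (PiHessian.pField p u))) := by
  have hn : 0 < n := by omega
  have hpβ : 0 < p - 1 - β := by linarith
  have hα1 : 0 < α + 1 := by
    have hk0 : (0 : ℝ) < k := by positivity
    have hn0 : (0 : ℝ) < n := by positivity
    have : 0 < (k : ℝ) / n := by positivity
    linarith
  have hm1 : 1 < 1 + (α + 1) / (p - 1 - β) := by
    have : 0 < (α + 1) / (p - 1 - β) := by positivity
    linarith
  refine ⟨fun hle => ⟨fun ⟨u, hu, hsub⟩ => ?_, fun hKO => ?_⟩, fun hlt hge δ hδ1 hδ => ?_⟩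
  · exact PiHessian.kellerOsserman_of_subsolution hk hkn hp hα hβ hf_pos hf_mono hf_cont
      (hu.of_le (by norm_num)) hu.contDiffOn hsub
  · obtain ⟨ψ, K, hψ, -, -, hsub⟩ :=
      PiHessian.exists_radial_subsolution hk hkn hp hα hβ hf_pos hf_mono hf_cont hKO
    refine ⟨_, PiHessian.contDiff_two_comp_norm_rpow hψ ?_, hsub⟩
    -- The case `p ≤ α + β + 2` is exactly `m ≥ 2`.
    have : 1 ≤ (α + 1) / (p - 1 - β) := by rw [one_le_div hpβ]; linarith
    linarith
  · have hex : PiHessian.KellerOsserman n k p β f →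
        ∃ u : PiHessian.Eucl n → ℝ, ContDiff ℝ 1 u ∧ ContDiffOn ℝ 2 u {0}ᶜ ∧
          PiHessian.MemW2Loc δ u ∧ PiHessian.IsEntireSubsolution k p α β f u ∧
          ContDiff ℝ 1 (PiHessian.pField p u) := by
      intro hKO
      obtain ⟨ψ, K, hψ, hψ', hK, hsub⟩ :=
        PiHessian.exists_radial_subsolution hk hkn hp hα hβ hf_pos hf_mono hf_cont hKO
      -- Hence `(2 - m) δ < 1` is the stated upper bound on `δ`.
      have h2m : 2 - (1 + (α + 1) / (p - 1 - β)) = (p - α - β - 2) / (p - 1 - β) := by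
        field_simp
        ring
      -- The exponent of `‖x‖` in the field is nonnegative exactly when `(p - 1) α + β ≥ 0`.
      have hs : (1 + (α + 1) / (p - 1 - β) - 1) * (p - 1) - 1 =
          ((p - 1) * α + β) / (p - 1 - β) := by
        field_simp
        ring
      have h2m0 : 0 < (p - α - β - 2) / (p - 1 - β) := div_pos (by linarith) hpβ
      refine ⟨_, PiHessian.contDiff_one_comp_norm_rpow hψ hm1,
        PiHessian.contDiffOn_two_comp_norm_rpow hψ,
        PiHessian.memW2Loc_comp_norm_rpow hn hψ hm1 (by linarith) hδ1.le ?_, hsub,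
        PiHessian.contDiff_pField_comp_norm_rpow hψ hψ' hK hm1 ?_⟩
      · rw [h2m, div_mul_eq_mul_div, div_lt_one hpβ]
        rw [lt_div_iff₀ (by linarith)] at hδ
        linarith
      · rw [hs]
        exact div_nonneg hge hpβ.le
    refine ⟨⟨fun ⟨u, hu1, hu2, _, hsub⟩ => ?_, fun hKO => ?_⟩, hex⟩
    · exact PiHessian.kellerOsserman_of_subsolution hk hkn hp hα hβ hf_pos hf_mono hf_cont
        hu1 hu2 hsub
    · obtain ⟨u, h1, h2, h3, h4, -⟩ := hex hKO
      exact ⟨u, h1, h2, h3, h4⟩
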